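/- \textbf{Definitions.} Let $T=p\,D_{zz}+q\,D_z+r$ be a differential operator whose coefficients $p,q,r\in\mathbb{R}(z)$ are real rational functions, $p\neq 0$. Its weight is $W=\frac1p\exp\left(\int^z\frac{q}{p}\,dx\right)$, determined up to a nonzero multiplicative constant. An eigenpolynomial of $T$ is a polynomial $y\ne0$ with $T[y]=\lambda y$ for a constant $\lambda$. Let $K\subset\mathbb{N}=\{0,1,2,\dots\}$ be a finite set, and let $y_k$, $k\in\mathbb{N}\setminus K$, be real polynomials with $\deg y_k=k$. They form a \emph{Sturm--Liouville orthogonal polynomial system} (SL-OPS), with operator $T$, interval $I$ and weight $W$, if (i) every $y_k$, $k\notin K$, is an eigenpolynomial of $T$, and $T$ has no eigenpolynomial whose degree belongs to $K$; (ii) $I\subset\mathbb{R}$ is a nonempty open interval, bounded or unbounded, such that (a) (a suitable constant multiple of) the weight $W$ is positive, single-valued (and continuous) and integrable on $I$; (b) all moments are finite, i.e. $z^jW(z)$ is integrable on $I$ for every $j\in\mathbb{N}$; (c) for every polynomial $y$, $y(z)p(z)W(z)\to0$ at the (finite or infinite) endpoints of $I$; (iii) the linear span of $\{y_k: k\in\mathbb{N}\setminus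 K\}$ is dense in $L^2(I,W(z)\,dz)$. An SL-OPS is of Hermite, Laguerre or Jacobi type if, respectively, for some real polynomial $\eta$ without zeros on $I$, \begin{align*} \text{(Hermite)}\quad & I=(-\infty,\infty), & W(z)&=\frac{e^{-z^2}}{\eta(z)^2};\\ \text{(Laguerre)}\quad & I=(0,\infty), & W(z)&=\frac{z^\alpha e^{-z}}{\eta(z)^2}\quad\text{with } \alpha>-1;\\ \text{(Jacobi)}\quad & I=(-1,1), & W(z)&=\frac{(1-z)^\alpha(1+z)^\beta}{\eta(z)^2}\quad\text{with } \alpha,\beta>-1. \end{align*} \textbf{Proposition.} Up to an affine change of variable, every SL-OPS is of one of these three types. That is, for every SL-OPS $(y_k)_{k\notin K}$ with operator $T$, interval $I$ and weight $W$ there are real numbers $a\neq0$ and $b$ such that, after the substitution $z=ax+b$, the polynomials $y_k(ax+b)$, with the operator $T$ written in the variable $x$, the interval $\{x: ax+b\in I\}$ and the weight $W(ax+b)$, form an SL-OPS of Hermite, Laguerre or Jacobi type. -/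

import Mathlib

open MeasureTheory Filter Topology Polynomial

noncomputable section

/-- A real second-order differential operator `T = p D² + q D + r` with rational coefficients and
`p ≠ 0`. -/
structure RatDiffOp2 where
  p : RatFunc ℝ
  q : RatFunc ℝ
  r : RatFunc ℝ
  p_ne_zero : p ≠ 0

/-- The value `T[y] = p y'' + q y' + r y`, a rational function, at a real polynomial `y`. -/
def RatDiffOp2.apply (T : RatDiffOp2) (y : ℝ[X]) : RatFunc ℝ :=
  T.p * algebraMap ℝ[X] (RatFunc ℝ) (derivative (derivative y))
    + T.q * algebraMap ℝ[X] (RatFunc ℝ) (derivative y)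
    + T.r * algebraMap ℝ[X] (RatFunc ℝ) y

/-- `y` is an eigenpolynomial of `T`. -/
def RatDiffOp2.IsEigenpoly (T : RatDiffOp2) (y : ℝ[X]) : Prop :=
  y ≠ 0 ∧ ∃ l : ℝ, T.apply y = algebraMap ℝ[X] (RatFunc ℝ) (C l * y)

/-- The value of a rational function at a real point (used only away from the poles, or in limits
in which the finitely many poles play no role). -/
def ratEval (f : RatFunc ℝ) (z : ℝ) : ℝ := f.eval (RingHom.id ℝ) z

/-- `W` is, on the set `I`, a single-valued positive branch of the weight
`W = P / p`, `P = exp (∫ q / p)` of `T`: it is positive and continuous on `I`, and `P = p W`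
satisfies `P' = (q / p) P = q W` at each point of `I` at which `p`, `q` have no pole and `p` does
not vanish.  (The weight of `T` is defined up to a multiplicative constant.) -/
structure RatDiffOp2.IsWeightOn (T : RatDiffOp2) (W : ℝ → ℝ) (I : Set ℝ) : Prop where
  pos : ∀ z ∈ I, 0 < W z
  continuousOn : ContinuousOn W I
  hasDerivAt : ∀ z ∈ I, T.p.denom.eval z ≠ 0 → T.q.denom.eval z ≠ 0 → T.p.num.eval z ≠ 0 →
    HasDerivAt (fun x => ratEval T.p x * W x) (ratEval T.q z * W z) z

/-- The data of a Sturm-Liouville polynomial system: the finite set `exc` of exceptional degrees,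
the polynomials `y k` (only those with `k ∉ exc` belong to the system), the operator `T`, the
interval `I` and the weight `W`. -/
structure SLData where
  exc : Finset ℕ
  y : ℕ → ℝ[X]
  T : RatDiffOp2
  I : Set ℝ
  W : ℝ → ℝ

namespace SLData

/-- The measure `W(z) dz` on `I`. -/
def measure (S : SLData) : Measure ℝ :=
  (volume.restrict S.I).withDensity (fun z => ENNReal.ofReal (S.W z))

/-- The linear span of the polynomials of the system. -/
def polySpan (S : SLData) : Submodule ℝ ℝ[X] :=
  Submodule.span ℝ {f | ∃ k, k ∉ S.exc ∧ f = S.y k}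

/-- The system is a Sturm-Liouville orthogonal polynomial system (SL-OPS). -/
structure IsSLOPS (S : SLData) : Prop where
  /-- there is one polynomial of the system in each non-exceptional degree -/
  degree_y : ∀ k, k ∉ S.exc → (S.y k).degree = (k : WithBot ℕ)
  /-- these polynomials are eigenpolynomials of the operator -/
  eigen : ∀ k, k ∉ S.exc → S.T.IsEigenpoly (S.y k)
  /-- there is no eigenpolynomial of an exceptional degree -/
  gap : ∀ k ∈ S.exc, ∀ f : ℝ[X], f.degree = (k : WithBot ℕ) → ¬ S.T.IsEigenpoly f
  /-- `I` is a non-empty open interval, bounded or not -/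
  isOpen_I : IsOpen S.I
  ordConnected_I : S.I.OrdConnected
  nonempty_I : S.I.Nonempty
  /-- `W` is the weight of `T`, positive and single-valued on `I` -/
  weight : S.T.IsWeightOn S.W S.I
  /-- `W` is integrable on `I` -/
  integrable : IntegrableOn S.W S.I
  /-- all moments are finite -/
  moments : ∀ j : ℕ, IntegrableOn (fun z => z ^ j * S.W z) S.I
  /-- `y p W → 0` at the finite endpoints of `I`, for each polynomial `y` -/
  boundary_finite : ∀ f : ℝ[X], ∀ e ∈ frontier S.I,
    Tendsto (fun z => f.eval z * ratEval S.T.p z * S.W z) (𝓝[S.I] e) (𝓝 0)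
  /-- `y p W → 0` at the infinite endpoints of `I` (no condition if `I` is bounded) -/
  boundary_infinite : ∀ f : ℝ[X],
    Tendsto (fun z => f.eval z * ratEval S.T.p z * S.W z) (cocompact ℝ ⊓ 𝓟 S.I) (𝓝 0)
  /-- the span of the system is dense in `L²(I, W dz)` -/
  dense : ∀ f : ℝ → ℝ, MemLp f 2 S.measure → ∀ ε : ℝ, 0 < ε →
    ∃ g ∈ S.polySpan, eLpNorm (fun z => f z - g.eval z) 2 S.measure ≤ ENNReal.ofReal ε

/-- Hermite type: `I = ℝ` and `W = exp(-z²) / η²`. -/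
def IsHermiteType (S : SLData) : Prop :=
  S.I = Set.univ ∧ ∃ η : ℝ[X], (∀ z ∈ S.I, η.eval z ≠ 0) ∧
    ∀ z ∈ S.I, S.W z = Real.exp (-z ^ 2) / (η.eval z) ^ 2

/-- Laguerre type: `I = (0, ∞)` and `W = z^α exp(-z) / η²` with `α > -1`. -/
def IsLaguerreType (S : SLData) : Prop :=
  S.I = Set.Ioi 0 ∧ ∃ α : ℝ, -1 < α ∧ ∃ η : ℝ[X], (∀ z ∈ S.I, η.eval z ≠ 0) ∧
    ∀ z ∈ S.I, S.W z = z ^ α * Real.exp (-z) / (η.eval z) ^ 2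

/-- Jacobi type: `I = (-1, 1)` and `W = (1 - z)^α (1 + z)^β / η²` with `α, β > -1`. -/
def IsJacobiType (S : SLData) : Prop :=
  S.I = Set.Ioo (-1) 1 ∧ ∃ α β : ℝ, -1 < α ∧ -1 < β ∧
    ∃ η : ℝ[X], (∀ z ∈ S.I, η.eval z ≠ 0) ∧
      ∀ z ∈ S.I, S.W z = (1 - z) ^ α * (1 + z) ^ β / (η.eval z) ^ 2

end SLData

/-- The rational function `x ↦ f (a x + b)`, for `a ≠ 0`. -/
def ratCompAffine (a b : ℝ) (f : RatFunc ℝ) : RatFunc ℝ :=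
  algebraMap ℝ[X] (RatFunc ℝ) (f.num.comp (C a * X + C b)) /
    algebraMap ℝ[X] (RatFunc ℝ) (f.denom.comp (C a * X + C b))

theorem ratCompAffine_ne_zero {a : ℝ} (ha : a ≠ 0) (b : ℝ) {f : RatFunc ℝ} (hf : f ≠ 0) :
    ratCompAffine a b f ≠ 0 := by
  have hdeg : (C a * X + C b : ℝ[X]).natDegree ≠ 0 := by
    rw [natDegree_linear ha]; exact one_ne_zero
  have key : ∀ g : ℝ[X], g ≠ 0 → g.comp (C a * X + C b) ≠ 0 := by
    intro g hg h
    rcases comp_eq_zero_iff.1 h with h | ⟨_, h⟩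
    · exact hg h
    · apply hdeg
      rw [h, natDegree_C]
  refine div_ne_zero ?_ ?_
  · exact RatFunc.algebraMap_ne_zero (key _ (RatFunc.num_ne_zero hf))
  · exact RatFunc.algebraMap_ne_zero (key _ (RatFunc.denom_ne_zero f))

/-- The operator `T` written in the variable `x`, where `z = a x + b` with `a ≠ 0`: by the chain
rule `d/dz = a⁻¹ d/dx`. -/
def RatDiffOp2.affine (T : RatDiffOp2) (a b : ℝ) (ha : a ≠ 0) : RatDiffOp2 where
  p := RatFunc.C (a ^ 2)⁻¹ * ratCompAffine a b T.p
  q := RatFunc.C a⁻¹ * ratCompAffine a b T.q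
  r := ratCompAffine a b T.r
  p_ne_zero := mul_ne_zero
    (by
      rw [Ne, map_eq_zero]
      exact inv_ne_zero (pow_ne_zero 2 ha))
    (ratCompAffine_ne_zero ha b T.p_ne_zero)

/-- The system `S` written in the variable `x`, where `z = a x + b` with `a ≠ 0`. -/
def SLData.affine (S : SLData) (a b : ℝ) (ha : a ≠ 0) : SLData where
  exc := S.exc
  y := fun k => (S.y k).comp (C a * X + C b)
  T := S.T.affine a b ha
  I := {x | a * x + b ∈ S.I}
  W := fun x => S.W (a * x + b)

end

/-! The eigenpolynomials span a space `U` of finite codimension in the polynomials, and `T` maps `U`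
into itself. This rigidity restricts the coefficients of `T` at every point, including infinity.

At a point, say `0`, multiply `T` by `z²` and the denominators to get an Euler operator. On a
polynomial of order `n` its lowest term is the indicial polynomial, of degree at most 2 in `n`,
times the lowest coefficient. If `T` lowers orders by `d`, an infinite descent in `U` puts an
indicial root in each residue class modulo `d` (`exists_indicial_root`). For `d ≥ 3` a quadratic
would have three roots, so `T` lowers orders by at most 2: its `p` has no pole, and its `q` at most
a simple one. For `d = 2` there is an even and an odd root, and their sum fixes the residue of `q`
as `-2νp` with `ν` a natural number (`local_structure_zero`). Comparing top coefficients gives the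
degree bounds (`natDegree_le`).

Applied at all complex points, this makes `p` a polynomial of degree at most 2 and gives `T.q = q -
2pη'/η` with polynomials `q` of degree at most 1 and `η` (`exists_naturalGauge`). Then `V = Wη²`
solves the Pearson equation `(pV)' = qV` of the classical weights.

A solution with `pV → 0` at a point where `p ≠ 0` vanishes nearby. Since `W > 0`, it follows that
`η` has no zero on `I` and that `p` vanishes at the finite endpoints. At an infinite endpoint the
decay of `pV` against all polynomials forces `deg p ≤ deg q` and a sign. Up to affine maps, the
line, a half-line and a bounded interval then yield the Hermite, Laguerre and Jacobi weights by
integrating `V'/V`; integrability of `V` gives exponents above `-1`. -/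

noncomputable section

/-! ### Indicial roots of operators with eigenpolynomials in almost all degrees -/

section Algebra

variable {F : Type*} [Field F]

theorem coeff_add_mul_of_X_pow_dvd {f g : F[X]} {m n : ℕ} (hf : X ^ m ∣ f) (hg : X ^ n ∣ g) :
    (f * g).coeff (m + n) = f.coeff m * g.coeff n := by
  obtain ⟨f, rfl⟩ := hf
  obtain ⟨g, rfl⟩ := hg
  have h : X ^ m * f * (X ^ n * g) = X ^ (m + n) * (f * g) := by ring
  rw [h]
  have h1 := coeff_X_pow_mul (f * g) (m + n) 0
  have h2 := coeff_X_pow_mul f m 0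
  have h3 := coeff_X_pow_mul g n 0
  rw [zero_add] at h1 h2 h3
  rw [h1, h2, h3, mul_coeff_zero]

/-- A second-order Euler operator `A θ₂ + B θ₁ + G` with `θ₁ = z D`, `θ₂ = z² D²`. -/
def eulerOp (A B G f : F[X]) : F[X] :=
  A * (X ^ 2 * derivative (derivative f)) + B * (X * derivative f) + G * f

theorem coeff_X_mul_derivative (f : F[X]) (n : ℕ) :
    (X * derivative f).coeff n = n * f.coeff n := by
  cases n with
  | zero => simp
  | succ n => rw [coeff_X_mul, coeff_derivative]; push_cast; ring

theorem coeff_X_sq_mul_derivative (f : F[X]) (n : ℕ) :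
    (X ^ 2 * derivative (derivative f)).coeff n = n * (n - 1) * f.coeff n := by
  rcases n with _ | _ | n
  · simp [pow_two, mul_assoc]
  · simp [pow_two, mul_assoc]
  · rw [coeff_X_pow_mul, coeff_derivative, coeff_derivative]; push_cast; ring

/-- The indicial polynomial of an Euler operator, for the coefficients in degree `a`. -/
def indicial (A B G : F[X]) (a n : ℕ) : F :=
  A.coeff a * (n * (n - 1)) + B.coeff a * n + G.coeff a

theorem X_pow_dvd_X_mul_derivative {f : F[X]} {n : ℕ} (hf : X ^ n ∣ f) :
    X ^ n ∣ X * derivative f := by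
  rw [X_pow_dvd_iff] at hf ⊢
  intro d hd
  rw [coeff_X_mul_derivative, hf d hd, mul_zero]

theorem X_pow_dvd_X_sq_mul_derivative {f : F[X]} {n : ℕ} (hf : X ^ n ∣ f) :
    X ^ n ∣ X ^ 2 * derivative (derivative f) := by
  rw [X_pow_dvd_iff] at hf ⊢
  intro d hd
  rw [coeff_X_sq_mul_derivative, hf d hd, mul_zero]

theorem X_pow_dvd_eulerOp {A B G f : F[X]} {a n : ℕ} (hA : X ^ a ∣ A) (hB : X ^ a ∣ B)
    (hG : X ^ a ∣ G) (hf : X ^ n ∣ f) : X ^ (a + n) ∣ eulerOp A B G f := by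
  rw [pow_add]
  exact dvd_add (dvd_add (mul_dvd_mul hA (X_pow_dvd_X_sq_mul_derivative hf))
    (mul_dvd_mul hB (X_pow_dvd_X_mul_derivative hf))) (mul_dvd_mul hG hf)

theorem coeff_eulerOp {A B G f : F[X]} {a n : ℕ} (hA : X ^ a ∣ A) (hB : X ^ a ∣ B)
    (hG : X ^ a ∣ G) (hf : X ^ n ∣ f) :
    (eulerOp A B G f).coeff (a + n) = indicial A B G a n * f.coeff n := by
  rw [eulerOp, coeff_add, coeff_add,
    coeff_add_mul_of_X_pow_dvd hA (X_pow_dvd_X_sq_mul_derivative hf),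
    coeff_add_mul_of_X_pow_dvd hB (X_pow_dvd_X_mul_derivative hf),
    coeff_add_mul_of_X_pow_dvd hG hf, coeff_X_sq_mul_derivative, coeff_X_mul_derivative, indicial]
  ring

theorem X_pow_natTrailingDegree_dvd (f : F[X]) : X ^ f.natTrailingDegree ∣ f := by
  rw [X_pow_dvd_iff]
  intro d hd
  exact coeff_eq_zero_of_lt_natTrailingDegree hd

theorem natTrailingDegree_eq_of_dvd {f : F[X]} {n : ℕ} (h : X ^ n ∣ f) (hn : f.coeff n ≠ 0) :
    f.natTrailingDegree = n := by
  apply le_antisymm (natTrailingDegree_le_of_ne_zero hn)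
  apply le_natTrailingDegree
  · rintro rfl; simp at hn
  · exact X_pow_dvd_iff.1 h

/-- If an Euler operator lowers the order at `0` by `e - a > 0` and preserves, up to the factor `H`,
a space with elements of almost all orders, then each residue class modulo `e - a` contains
an indicial root. -/
theorem exists_indicial_root {U : Set F[X]}
    (hU : ∀ s : Set ℕ, s.Infinite → ∃ f ∈ U, f ≠ 0 ∧ f.natTrailingDegree ∈ s)
    {A B G H : F[X]} {a : ℕ} (hA : X ^ a ∣ A) (hB : X ^ a ∣ B) (hG : X ^ a ∣ G) (hH : H ≠ 0)
    (hT : ∀ f ∈ U, ∃ g ∈ U, eulerOp A B G f = H * g) (ha : a < H.natTrailingDegree) (c : ℕ) :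
    ∃ n : ℕ, n ≡ c [MOD H.natTrailingDegree - a] ∧ indicial A B G a n = 0 := by
  set d := H.natTrailingDegree - a with hd
  by_contra! hcon
  -- Descent: with no indicial root in the class, an element of `U` of order `n` has image `H * g`
  -- with `g ∈ U` of order exactly `n - d`, again in the class. This cannot go on in `ℕ`.
  have key : ∀ n : ℕ, n ≡ c [MOD d] → ∀ f ∈ U, f ≠ 0 → f.natTrailingDegree ≠ n := by
    intro n
    induction n using Nat.strong_induction_on with
    | _ n ih =>
      intro hn f hf hf0 hfn
      obtain ⟨g, hg, hfg⟩ := hT f hf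
      have hXf : X ^ n ∣ f := hfn ▸ X_pow_natTrailingDegree_dvd f
      have hcf : f.coeff n ≠ 0 := by
        rw [← hfn]; exact trailingCoeff_nonzero_iff_nonzero.2 hf0
      have h1 : (eulerOp A B G f).coeff (a + n) ≠ 0 := by
        rw [coeff_eulerOp hA hB hG hXf]
        exact mul_ne_zero (hcon n hn) hcf
      have h2 := natTrailingDegree_eq_of_dvd (X_pow_dvd_eulerOp hA hB hG hXf) h1
      have hg0 : g ≠ 0 := by
        rintro rfl
        rw [hfg] at h1; simp at h1
      rw [hfg, natTrailingDegree_mul hH hg0] at h2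
      refine ih g.natTrailingDegree (by omega) ?_ g hg hg0 rfl
      have : n = g.natTrailingDegree + d := by omega
      rw [this] at hn
      simpa [Nat.ModEq] using hn
  have hinf : {n : ℕ | n ≡ c [MOD d]}.Infinite := by
    refine Set.infinite_of_injective_forall_mem (f := fun k : ℕ => c + d * k) ?_ ?_
    · intro x y hxy
      have : d ≠ 0 := by omega
      simpa [this] using hxy
    · intro k
      simp [Nat.ModEq]
  obtain ⟨f, hf, hf0, hfs⟩ := hU _ hinf
  exact key _ hfs f hf hf0 rfl

/-- A second-order operator `(P D² + Q D + R) / E` (with denominators cleared) that has, for each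
degree outside of a finite set, an eigenpolynomial of this degree. -/
structure HasEigenpolys (P Q R E : F[X]) (K : Finset ℕ) (y : ℕ → F[X]) : Prop where
  denom_ne_zero : E ≠ 0
  degree_eq : ∀ k, k ∉ K → (y k).degree = k
  eigen : ∀ k, k ∉ K → ∃ l : F,
    P * derivative (derivative (y k)) + Q * derivative (y k) + R * y k = E * (C l * y k)

namespace HasEigenpolys

variable {P Q R E : F[X]} {K : Finset ℕ} {y : ℕ → F[X]}

/-- The span of the eigenpolynomials. -/
def eigenSpan (K : Finset ℕ) (y : ℕ → F[X]) : Submodule F F[X] :=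
  Submodule.span F (y '' {k | k ∉ K})

theorem exists_mem_eigenSpan (h : HasEigenpolys P Q R E K y) {f : F[X]}
    (hf : f ∈ eigenSpan K y) : ∃ g ∈ eigenSpan K y,
      P * derivative (derivative f) + Q * derivative f + R * f = E * g := by
  induction hf using Submodule.span_induction with
  | mem f hf =>
    obtain ⟨k, hk, rfl⟩ := hf
    obtain ⟨l, hl⟩ := h.eigen k hk
    refine ⟨C l * y k, ?_, hl⟩
    rw [← smul_eq_C_mul]
    exact Submodule.smul_mem _ _ (Submodule.subset_span ⟨k, hk, rfl⟩)
  | zero => exact ⟨0, Submodule.zero_mem _, by simp⟩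
  | add f₁ f₂ _ _ h₁ h₂ =>
    obtain ⟨g₁, hg₁, e₁⟩ := h₁
    obtain ⟨g₂, hg₂, e₂⟩ := h₂
    refine ⟨g₁ + g₂, Submodule.add_mem _ hg₁ hg₂, ?_⟩
    simp only [derivative_add]
    linear_combination e₁ + e₂
  | smul c f _ h₁ =>
    obtain ⟨g, hg, e⟩ := h₁
    refine ⟨c • g, Submodule.smul_mem _ _ hg, ?_⟩
    simp only [smul_eq_C_mul, derivative_C_mul]
    linear_combination C c * e

/-- Division with remainder by the `y n`: above `K.sup id` every degree is available to cancel a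
leading term. -/
theorem exists_add_of_degree (h : HasEigenpolys P Q R E K y) (f : F[X]) :
    ∃ u ∈ eigenSpan K y, f - u ∈ degreeLT F (K.sup id + 1) := by
  by_cases hf0 : f = 0
  · exact ⟨0, Submodule.zero_mem _, by simp [hf0]⟩
  induction hn : f.natDegree using Nat.strong_induction_on generalizing f with
  | _ n ih =>
    by_cases hnK : n < K.sup id + 1
    · refine ⟨0, Submodule.zero_mem _, ?_⟩
      rw [sub_zero, mem_degreeLT, degree_eq_natDegree hf0, hn]
      exact_mod_cast hnK
    have hk : n ∉ K := by
      intro hk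
      have : n ≤ K.sup id := Finset.le_sup (f := id) hk
      omega
    have hy := h.degree_eq n hk
    have hy0 : y n ≠ 0 := by rintro h0; simp [h0] at hy
    set c := f.leadingCoeff / (y n).leadingCoeff
    have hmem : c • y n ∈ eigenSpan K y :=
      Submodule.smul_mem _ _ (Submodule.subset_span ⟨n, hk, rfl⟩)
    have hlt : (f - c • y n).degree < f.degree := by
      have hc : c ≠ 0 := div_ne_zero (leadingCoeff_ne_zero.2 hf0) (leadingCoeff_ne_zero.2 hy0)
      refine degree_sub_lt_left ?_ hf0 ?_
      · rw [degree_smul_of_smul_regular _ (IsSMulRegular.of_ne_zero hc), hy,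
          degree_eq_natDegree hf0, hn]
      · rw [smul_eq_C_mul, leadingCoeff_mul, leadingCoeff_C]
        exact (div_mul_cancel₀ _ (leadingCoeff_ne_zero.2 hy0)).symm
    by_cases h0 : f - c • y n = 0
    · exact ⟨c • y n, hmem, by rw [h0]; exact Submodule.zero_mem _⟩
    · obtain ⟨u, hu, hu'⟩ := ih _ (lt_of_lt_of_eq (natDegree_lt_natDegree h0 hlt) hn) _ h0 rfl
      refine ⟨c • y n + u, Submodule.add_mem _ hmem hu, ?_⟩
      rwa [← sub_sub]

theorem finite_quotient (h : HasEigenpolys P Q R E K y) :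
    Module.Finite F (F[X] ⧸ eigenSpan K y) := by
  have hfin : Module.Finite F (degreeLT F (K.sup id + 1)) :=
    Module.Finite.equiv (degreeLTEquiv F (K.sup id + 1)).symm
  refine Module.Finite.of_surjective
    ((eigenSpan K y).mkQ.comp (degreeLT F (K.sup id + 1)).subtype) ?_
  intro x
  obtain ⟨f, rfl⟩ := Submodule.mkQ_surjective _ x
  obtain ⟨u, hu, hu'⟩ := h.exists_add_of_degree f
  refine ⟨⟨_, hu'⟩, ?_⟩
  simp only [LinearMap.comp_apply, Submodule.subtype_apply, map_sub]
  rw [sub_eq_self]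
  simpa using hu

/-- Modulo a subspace of finite codimension, the monomials with exponents in an infinite `s` are
dependent. A nontrivial relation is an element of the span all of whose exponents, the lowest
included, lie in `s`. -/
theorem exists_natTrailingDegree_mem (h : HasEigenpolys P Q R E K y) (s : Set ℕ)
    (hs : s.Infinite) :
    ∃ f ∈ (eigenSpan K y : Set F[X]), f ≠ 0 ∧ f.natTrailingDegree ∈ s := by
  have := h.finite_quotient
  have : Infinite s := hs.to_subtype
  have hli : ¬ LinearIndependent F (fun n : s => (eigenSpan K y).mkQ (X ^ (n : ℕ))) :=
    fun hli => not_finite_iff_infinite.2 this hli.finite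
  rw [not_linearIndependent_iff] at hli
  obtain ⟨t, c, hsum, i, hi, hci⟩ := hli
  set f : F[X] := ∑ n ∈ t, c n • X ^ (n : ℕ) with hf
  have hcoeff : ∀ j : ℕ, f.coeff j = ∑ n ∈ t, if j = n then c n else 0 := by
    intro j
    rw [hf, finsetSum_coeff]
    refine Finset.sum_congr rfl fun n _ => ?_
    rw [coeff_smul, coeff_X_pow]
    simp
  have hf0 : f ≠ 0 := by
    intro h0
    have := hcoeff i
    rw [h0, coeff_zero, Finset.sum_eq_single i] at this
    · simp at this; exact hci this.symm
    · intro b _ hb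
      rw [if_neg]
      exact fun h => hb (Subtype.ext h.symm)
    · exact fun h => absurd hi h
  refine ⟨f, ?_, hf0, ?_⟩
  · rw [SetLike.mem_coe, ← Submodule.Quotient.mk_eq_zero, ← Submodule.mkQ_apply, hf, map_sum]
    simpa using hsum
  · have h1 : f.coeff f.natTrailingDegree ≠ 0 := trailingCoeff_nonzero_iff_nonzero.2 hf0
    rw [hcoeff] at h1
    obtain ⟨n, _, hn⟩ := Finset.exists_ne_zero_of_sum_ne_zero h1
    have : f.natTrailingDegree = n := by
      by_contra hne
      simp [hne] at hn
    rw [this]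
    exact n.2

theorem comp_X_add_C (h : HasEigenpolys P Q R E K y) (z : F) :
    HasEigenpolys (P.comp (X + C z)) (Q.comp (X + C z)) (R.comp (X + C z)) (E.comp (X + C z)) K
      (fun k => (y k).comp (X + C z)) where
  denom_ne_zero := by
    intro h0
    rw [← taylor_apply] at h0
    exact h.denom_ne_zero ((taylor_injective z).eq_iff' (map_zero _) |>.1 h0)
  degree_eq k hk := by
    have := degree_taylor (y k) z
    rw [taylor_apply] at this
    rw [this, h.degree_eq k hk]
  eigen k hk := by
    obtain ⟨l, hl⟩ := h.eigen k hk
    refine ⟨l, ?_⟩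
    have := congrArg (fun f => f.comp (X + C z)) hl
    simpa [derivative_comp] using this

section CharZero

variable [CharZero F]

/-- Roots in the classes of `0`, `1`, `2` are distinct when `3 ≤ d`, and a polynomial of degree at
most 2 with three roots is zero; divided differences make this explicit. -/
theorem coeff_eq_zero_of_indicial_roots {A B G : F[X]} {a d : ℕ} (hd3 : 3 ≤ d)
    (hroot : ∀ c : ℕ, ∃ n : ℕ, n ≡ c [MOD d] ∧ indicial A B G a n = 0) :
    A.coeff a = 0 ∧ B.coeff a = 0 ∧ G.coeff a = 0 := by
  obtain ⟨n₀, h₀, e₀⟩ := hroot 0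
  obtain ⟨n₁, h₁, e₁⟩ := hroot 1
  obtain ⟨n₂, h₂, e₂⟩ := hroot 2
  have h01 : (n₀ : F) ≠ n₁ := by
    intro h
    rw [Nat.cast_inj.1 h] at h₀
    have := (h₀.symm.trans h₁)
    rw [Nat.ModEq, Nat.mod_eq_of_lt (by omega), Nat.mod_eq_of_lt (by omega)] at this
    omega
  have h02 : (n₀ : F) ≠ n₂ := by
    intro h
    rw [Nat.cast_inj.1 h] at h₀
    have := (h₀.symm.trans h₂)
    rw [Nat.ModEq, Nat.mod_eq_of_lt (by omega), Nat.mod_eq_of_lt (by omega)] at this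
    omega
  have h12 : (n₁ : F) ≠ n₂ := by
    intro h
    rw [Nat.cast_inj.1 h] at h₁
    have := (h₁.symm.trans h₂)
    rw [Nat.ModEq, Nat.mod_eq_of_lt (by omega), Nat.mod_eq_of_lt (by omega)] at this
    omega
  unfold indicial at e₀ e₁ e₂
  have k01 : A.coeff a * (n₀ + n₁ - 1) + B.coeff a = 0 := by
    apply mul_left_cancel₀ (sub_ne_zero.2 h01)
    linear_combination e₀ - e₁
  have k02 : A.coeff a * (n₀ + n₂ - 1) + B.coeff a = 0 := by
    apply mul_left_cancel₀ (sub_ne_zero.2 h02)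
    linear_combination e₀ - e₂
  have hA : A.coeff a = 0 := by
    apply mul_left_cancel₀ (sub_ne_zero.2 h12)
    linear_combination k01 - k02
  rw [hA] at k01 e₀
  have hB : B.coeff a = 0 := by simpa using k01
  rw [hB] at e₀
  exact ⟨hA, hB, by simpa using e₀⟩

/-- Local behaviour at `0`: `P / E` has no pole, `Q / E` at most a simple one, and at a simple pole
`(Q / E) / (P / E)` has an even non-positive residue. -/
theorem local_structure_zero (h : HasEigenpolys P Q R E K y) :
    X ^ E.natTrailingDegree ∣ P ∧ X ^ E.natTrailingDegree ∣ X * Q ∧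
      ∃ ν : ℕ, (X * Q).coeff E.natTrailingDegree = -(2 * ν * P.coeff E.natTrailingDegree) := by
  set s := E.natTrailingDegree with hs
  have hH : X ^ 2 * E ≠ 0 := mul_ne_zero (pow_ne_zero _ X_ne_zero) h.denom_ne_zero
  have hHs : (X ^ 2 * E).natTrailingDegree = s + 2 := by
    rw [natTrailingDegree_mul (pow_ne_zero _ X_ne_zero) h.denom_ne_zero, natTrailingDegree_X_pow,
      add_comm]
  have hT : ∀ f ∈ (eigenSpan K y : Set F[X]), ∃ g ∈ (eigenSpan K y : Set F[X]),
      eulerOp P (X * Q) (X ^ 2 * R) f = X ^ 2 * E * g := by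
    intro f hf
    obtain ⟨g, hg, e⟩ := h.exists_mem_eigenSpan hf
    refine ⟨g, hg, ?_⟩
    rw [eulerOp]
    linear_combination X ^ 2 * e
  -- As long as `a < s`, the drop in order `s + 2 - a` is at least 3, so the coefficients in degree
  -- `a` vanish and `a` can be raised.
  have hall : ∀ a ≤ s, X ^ a ∣ P ∧ X ^ a ∣ X * Q ∧ X ^ a ∣ X ^ 2 * R := by
    intro a
    induction a with
    | zero => simp
    | succ a ih =>
      intro ha
      obtain ⟨hP, hQ, hR⟩ := ih (by omega)
      have hroot := exists_indicial_root h.exists_natTrailingDegree_mem hP hQ hR hH hT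
        (by omega)
      obtain ⟨h1, h2, h3⟩ := coeff_eq_zero_of_indicial_roots (by omega) hroot
      have step : ∀ f : F[X], X ^ a ∣ f → f.coeff a = 0 → X ^ (a + 1) ∣ f := by
        intro f hf hfa
        rw [X_pow_dvd_iff] at hf ⊢
        intro d hd
        rcases Nat.lt_succ_iff_lt_or_eq.1 hd with h | rfl
        · exact hf d h
        · exact hfa
      exact ⟨step _ hP h1, step _ hQ h2, step _ hR h3⟩
  obtain ⟨hP, hQ, hR⟩ := hall s le_rfl
  refine ⟨hP, hQ, ?_⟩
  have hroot := exists_indicial_root h.exists_natTrailingDegree_mem hP hQ hR hH hT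
        (by omega)
  have hd : (X ^ 2 * E).natTrailingDegree - s = 2 := by omega
  rw [hd] at hroot
  obtain ⟨n₀, h₀, e₀⟩ := hroot 0
  obtain ⟨n₁, h₁, e₁⟩ := hroot 1
  -- The drop is now 2. The even and the odd root have an odd sum, and the sum of the roots
  -- determines the ratio of the two top indicial coefficients.
  obtain ⟨ν, hν⟩ : ∃ ν : ℕ, n₀ + n₁ = 2 * ν + 1 := by
    refine ⟨(n₀ + n₁) / 2, ?_⟩
    have h₀' : n₀ % 2 = 0 := h₀
    have h₁' : n₁ % 2 = 1 := h₁
    omega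
  refine ⟨ν, ?_⟩
  have h01 : (n₀ : F) ≠ n₁ := by
    intro h
    rw [Nat.cast_inj.1 h] at h₀
    have := (h₀.symm.trans h₁)
    simp [Nat.ModEq] at this
  have hν' : (n₀ : F) + n₁ = 2 * ν + 1 := by exact_mod_cast hν
  unfold indicial at e₀ e₁
  have k01 : P.coeff s * (n₀ + n₁ - 1) + (X * Q).coeff s = 0 := by
    apply mul_left_cancel₀ (sub_ne_zero.2 h01)
    linear_combination e₀ - e₁
  rw [hν'] at k01
  linear_combination k01

/-- Behaviour at infinity: `P / E` has degree at most `2`, and `Q / E` at most `1`. -/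
theorem natDegree_le (h : HasEigenpolys P Q R E K y) :
    P.natDegree ≤ E.natDegree + 2 ∧ (X * Q).natDegree ≤ E.natDegree + 2 := by
  set b := max P.natDegree (max (X * Q).natDegree (X ^ 2 * R).natDegree) with hb
  have hPb : P.natDegree ≤ b := le_max_left _ _
  have hQb : (X * Q).natDegree ≤ b := le_max_of_le_right (le_max_left _ _)
  have hRb : (X ^ 2 * R).natDegree ≤ b := le_max_of_le_right (le_max_right _ _)
  suffices hle : b ≤ E.natDegree + 2 from ⟨hPb.trans hle, hQb.trans hle⟩
  by_contra! hlt
  -- The eigenvalue side has degree at most `E.natDegree + 2 + k < b + k`, so the coefficient of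
  -- degree `b + k` on the other side must vanish.
  have hzero : ∀ k, k ∉ K → indicial P (X * Q) (X ^ 2 * R) b k = 0 := by
    intro k hk
    obtain ⟨l, hl⟩ := h.eigen k hk
    have hy := h.degree_eq k hk
    have hyn : (y k).natDegree = k := natDegree_eq_of_degree_eq_some hy
    have hy0 : y k ≠ 0 := by rintro h0; simp [h0] at hy
    have hyc : (y k).coeff k ≠ 0 := by
      have := leadingCoeff_ne_zero.2 hy0
      rwa [leadingCoeff, hyn] at this
    have hd1 : (X * derivative (y k)).natDegree ≤ k := by
      rw [natDegree_le_iff_coeff_eq_zero]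
      intro j hj
      rw [coeff_X_mul_derivative, coeff_eq_zero_of_natDegree_lt (by omega), mul_zero]
    have hd2 : (X ^ 2 * derivative (derivative (y k))).natDegree ≤ k := by
      rw [natDegree_le_iff_coeff_eq_zero]
      intro j hj
      rw [coeff_X_sq_mul_derivative, coeff_eq_zero_of_natDegree_lt (by omega), mul_zero]
    have h1 : (eulerOp P (X * Q) (X ^ 2 * R) (y k)).coeff (b + k)
        = indicial P (X * Q) (X ^ 2 * R) b k * (y k).coeff k := by
      rw [eulerOp, coeff_add, coeff_add, coeff_mul_add_eq_of_natDegree_le hPb hd2,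
        coeff_mul_add_eq_of_natDegree_le hQb hd1, coeff_mul_add_eq_of_natDegree_le hRb hyn.le,
        coeff_X_sq_mul_derivative, coeff_X_mul_derivative, indicial]
      ring
    have h2 : eulerOp P (X * Q) (X ^ 2 * R) (y k) = X ^ 2 * E * (C l * y k) := by
      rw [eulerOp]
      linear_combination X ^ 2 * hl
    have h3 : (X ^ 2 * E * (C l * y k)).natDegree < b + k := by
      have e1 := natDegree_mul_le (p := X ^ 2 * E) (q := C l * y k)
      have e2 := natDegree_mul_le (p := X ^ 2) (q := E)
      have e3 := natDegree_C_mul_le l (y k)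
      rw [natDegree_X_pow] at e2
      omega
    rw [h2, coeff_eq_zero_of_natDegree_lt h3] at h1
    exact (mul_eq_zero.1 h1.symm).resolve_right hyc
  have hroot : ∀ c : ℕ, ∃ n : ℕ, n ≡ c [MOD 3] ∧ indicial P (X * Q) (X ^ 2 * R) b n = 0 := by
    intro c
    -- This representative of the class of `c` exceeds every element of `K`.
    refine ⟨c + 3 * (K.sup id + 1), by simp [Nat.ModEq], hzero _ fun hk => ?_⟩
    have := Finset.le_sup (f := id) hk
    simp only [id] at this
    omega
  obtain ⟨h1, h2, h3⟩ := coeff_eq_zero_of_indicial_roots le_rfl hroot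
  have hne : ∀ f : F[X], f.natDegree = b → f.coeff b ≠ 0 := by
    intro f hf
    have hf0 : f ≠ 0 := by rintro rfl; simp at hf; omega
    have := leadingCoeff_ne_zero.2 hf0
    rwa [leadingCoeff, hf] at this
  rcases max_choice P.natDegree (max (X * Q).natDegree (X ^ 2 * R).natDegree) with hm | hm
  · exact hne P (by rw [hb, hm]) h1
  · rcases max_choice (X * Q).natDegree (X ^ 2 * R).natDegree with hm' | hm'
    · exact hne _ (by rw [hb, hm, hm']) h2
    · exact hne _ (by rw [hb, hm, hm']) h3

end CharZero

end HasEigenpolys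

end Algebra
-- Local exponents at complex poles and the natural gauge
section Structure

variable {F : Type*} [Field F]

namespace HasEigenpolys

variable {P Q R E : F[X]} {K : Finset ℕ} {y : ℕ → F[X]}

theorem map {F' : Type*} [Field F'] (h : HasEigenpolys P Q R E K y) (φ : F →+* F') :
    HasEigenpolys (P.map φ) (Q.map φ) (R.map φ) (E.map φ) K (fun k => (y k).map φ) where
  denom_ne_zero := (Polynomial.map_ne_zero_iff φ.injective).2 h.denom_ne_zero
  degree_eq k hk := by rw [degree_map, h.degree_eq k hk]
  eigen k hk := by
    obtain ⟨l, hl⟩ := h.eigen k hk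
    refine ⟨φ l, ?_⟩
    have := congrArg (Polynomial.map φ) hl
    simpa [derivative_map] using this

theorem X_pow_dvd_of_mul {f u : F[X]} {n : ℕ} (hu : u ≠ 0)
    (h : X ^ (n + u.natTrailingDegree) ∣ f * u) : X ^ n ∣ f := by
  by_cases hf : f = 0
  · simp [hf]
  refine (pow_dvd_pow X ?_).trans (X_pow_natTrailingDegree_dvd f)
  by_contra! hlt
  have h1 := X_pow_dvd_iff.1 h (f.natTrailingDegree + u.natTrailingDegree) (by omega)
  rw [← natTrailingDegree_mul hf hu] at h1
  exact trailingCoeff_nonzero_iff_nonzero.2 (mul_ne_zero hf hu) h1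

variable [CharZero F]

/-- The common factor `u` left by clearing denominators is harmless because orders at `0` add. -/
theorem coeff_zero_of_denom_zero {n d u : F[X]} (h : HasEigenpolys (n * u) Q R (d * u) K y)
    (hd : d.coeff 0 = 0) : n.coeff 0 = 0 := by
  obtain ⟨hd0, hu0⟩ := mul_ne_zero_iff.1 h.denom_ne_zero
  have h1 := h.local_structure_zero.1
  rw [natTrailingDegree_mul hd0 hu0] at h1
  refine X_pow_dvd_iff.1 (X_pow_dvd_of_mul hu0 h1) 0 ?_
  rw [Nat.pos_iff_ne_zero]
  intro h0
  rw [natTrailingDegree_eq_zero] at h0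
  tauto

theorem eval_eq_zero_of_denom {n d u : F[X]} (h : HasEigenpolys (n * u) Q R (d * u) K y)
    {z : F} (hd : d.eval z = 0) : n.eval z = 0 := by
  have h1 := h.comp_X_add_C z
  rw [mul_comp, mul_comp] at h1
  have h2 := h1.coeff_zero_of_denom_zero (by rw [← taylor_apply, taylor_coeff_zero, hd])
  rwa [← taylor_apply, taylor_coeff_zero] at h2

/-- Here `n / d` is the first-order coefficient. Its order at `0` is at least `-1`, so `d` has a
simple zero when `n` does not vanish; cancelling the lowest coefficient of `u` leaves the residue
condition. -/
theorem residue_zero {p n d u : F[X]} (h : HasEigenpolys (p * (d * u)) (n * u) R (d * u) K y)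
    (hd : d.coeff 0 = 0) (hn : n.coeff 0 ≠ 0) :
    d.coeff 1 ≠ 0 ∧ ∃ ν : ℕ, n.coeff 0 + 2 * ν * (p.coeff 0 * d.coeff 1) = 0 := by
  obtain ⟨hd0, hu0⟩ := mul_ne_zero_iff.1 h.denom_ne_zero
  obtain ⟨-, h1, ν, hν⟩ := h.local_structure_zero
  rw [natTrailingDegree_mul hd0 hu0] at h1 hν
  rw [← mul_assoc] at h1 hν
  have h2 := X_pow_dvd_of_mul hu0 h1
  have hle : d.natTrailingDegree ≤ 1 := by
    by_contra! hlt
    have := X_pow_dvd_iff.1 h2 1 hlt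
    rw [coeff_X_mul] at this
    exact hn this
  have hne : d.natTrailingDegree ≠ 0 := by
    intro h0
    rw [natTrailingDegree_eq_zero] at h0
    tauto
  have heq : d.natTrailingDegree = 1 := by omega
  have hd1 : d.coeff 1 ≠ 0 := heq ▸ trailingCoeff_nonzero_iff_nonzero.2 hd0
  refine ⟨hd1, ν, ?_⟩
  have hXd : X ^ 1 ∣ d := heq ▸ X_pow_natTrailingDegree_dvd d
  have hXu := X_pow_natTrailingDegree_dvd u
  have hu1 : u.coeff u.natTrailingDegree ≠ 0 := trailingCoeff_nonzero_iff_nonzero.2 hu0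
  have e1 : (X * n * u).coeff (1 + u.natTrailingDegree)
      = n.coeff 0 * u.coeff u.natTrailingDegree := by
    rw [coeff_add_mul_of_X_pow_dvd (by simp) hXu, coeff_X_mul]
  have e2 : (p * (d * u)).coeff (1 + u.natTrailingDegree)
      = p.coeff 0 * (d.coeff 1 * u.coeff u.natTrailingDegree) := by
    have h3 : X ^ (1 + u.natTrailingDegree) ∣ d * u := by
      rw [pow_add]; exact mul_dvd_mul hXd hXu
    have h4 := coeff_add_mul_of_X_pow_dvd (m := 0) (f := p) (by simp) h3
    rw [zero_add] at h4
    rw [h4, coeff_add_mul_of_X_pow_dvd hXd hXu]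
  rw [heq, e1, e2] at hν
  apply mul_right_cancel₀ hu1
  linear_combination hν

theorem residue {p n d u : F[X]} (h : HasEigenpolys (p * (d * u)) (n * u) R (d * u) K y)
    {z : F} (hd : d.eval z = 0) (hn : n.eval z ≠ 0) :
    (derivative d).eval z ≠ 0 ∧
      ∃ ν : ℕ, n.eval z + 2 * ν * (p.eval z * (derivative d).eval z) = 0 := by
  have h1 := h.comp_X_add_C z
  rw [mul_comp, mul_comp, mul_comp] at h1
  have h2 := h1.residue_zero (by rw [← taylor_apply, taylor_coeff_zero, hd])
    (by rwa [← taylor_apply, taylor_coeff_zero])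
  simpa only [← taylor_apply, taylor_coeff_zero, taylor_coeff_one] using h2

end HasEigenpolys

theorem eval_ne_zero_of_isCoprime {f g : F[X]} (h : IsCoprime f g) {z : F} (hg : g.eval z = 0) :
    f.eval z ≠ 0 := by
  obtain ⟨a, b, hab⟩ := h
  intro hf
  have := congrArg (Polynomial.eval z) hab
  simp [hf, hg] at this

/-- Otherwise `f` and `g` are coprime, and a Bézout identity survives the field extension, which
excludes a common root. -/
theorem dvd_of_irreducible_of_common_root {F' : Type*} [Field F'] (φ : F →+* F') {f g : F[X]}
    (hf : Irreducible f) {z : F'} (hfz : (f.map φ).eval z = 0) (hgz : (g.map φ).eval z = 0) :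
    f ∣ g := by
  by_contra hdvd
  have hc := (hf.coprime_iff_not_dvd.2 hdvd).map (mapRingHom φ)
  exact eval_ne_zero_of_isCoprime hc hgz hfz

/-- Solves `η' / η = M / d` with `d ∣ n + 2 p M`, for given local exponents. -/
theorem exists_log_derivative {d n p : F[X]} (hd : d.Monic) (hsq : Squarefree d)
    (hν : ∀ f : F[X], Irreducible f → f ∣ d → ∃ ν : ℕ, f ∣ n + 2 * C (ν : F) * (p * derivative d)) :
    ∃ η M : F[X], η ≠ 0 ∧ (∀ x, η.eval x = 0 → d.eval x = 0) ∧ d * derivative η = M * η ∧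
      d ∣ n + 2 * p * M := by
  classical
  have hnodup := (UniqueFactorizationMonoid.squarefree_iff_nodup_normalizedFactors hd.ne_zero).1 hsq
  set s : Finset F[X] := ⟨UniqueFactorizationMonoid.normalizedFactors d, hnodup⟩ with hs
  have hprod : ∏ f ∈ s, f = d := by
    have := UniqueFactorizationMonoid.prod_normalizedFactors_eq hd.ne_zero
    rw [hd.normalize_eq_self] at this
    rw [Finset.prod, hs]
    simpa using this
  have hirr : ∀ f ∈ s, Irreducible f := fun f hf =>
    UniqueFactorizationMonoid.irreducible_of_normalized_factor f hf
  have hdvd : ∀ f ∈ s, f ∣ d := fun f hf =>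
    UniqueFactorizationMonoid.dvd_of_mem_normalizedFactors hf
  have hmonic : ∀ f ∈ s, f.Monic := fun f hf => by
    have h1 := UniqueFactorizationMonoid.normalize_normalized_factor f hf
    rw [← h1]
    exact monic_normalize (hirr f hf).ne_zero
  choose! ν hν using hν
  have hder : derivative d = ∑ f ∈ s, (∏ g ∈ s.erase f, g) * derivative f := by
    conv_lhs => rw [← hprod]
    exact derivative_prod_finset
  -- The exponents prescribed at the factors of `d` define `η`; `M` is `d * η' / η` with the
  -- denominators cancelled.
  refine ⟨∏ f ∈ s, f ^ ν f, ∑ f ∈ s, (∏ g ∈ s.erase f, g) * (C (ν f : F) * derivative f),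
    ?_, ?_, ?_, ?_⟩
  · exact Finset.prod_ne_zero_iff.2 fun f hf => pow_ne_zero _ (hirr f hf).ne_zero
  · intro x hx
    rw [eval_prod, Finset.prod_eq_zero_iff] at hx
    obtain ⟨f, hf, hfx⟩ := hx
    rw [eval_pow] at hfx
    exact eval_eq_zero_of_dvd_of_eval_eq_zero (hdvd f hf) (eq_zero_of_pow_eq_zero hfx)
  · rw [derivative_prod_finset, Finset.mul_sum, Finset.sum_mul]
    refine Finset.sum_congr rfl fun f hf => ?_
    have h1 : d = f * ∏ g ∈ s.erase f, g := by
      rw [Finset.mul_prod_erase s (fun g => g) hf, hprod]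
    have h2 : ∏ g ∈ s, g ^ ν g = f ^ ν f * ∏ g ∈ s.erase f, g ^ ν g :=
      (Finset.mul_prod_erase s _ hf).symm
    rw [h2, derivative_pow]
    conv_lhs => rw [h1]
    -- The exponent `ν f - 1` is truncated at `ν f = 0`, where the coefficient vanishes anyway.
    rcases Nat.eq_zero_or_pos (ν f) with h0 | h0
    · simp [h0]
    · have h3 : f ^ ν f = f * f ^ (ν f - 1) := by rw [← pow_succ']; congr 1; omega
      rw [h3]
      ring
  · conv_lhs => rw [← hprod]
    refine Finset.prod_dvd_of_coprime ?_ ?_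
    · intro f hf g hg hfg
      rw [Function.onFun]
      refine ((hirr f hf).coprime_iff_not_dvd).2 fun h => hfg ?_
      exact eq_of_monic_of_associated (hmonic f hf) (hmonic g hg)
        ((hirr f hf).associated_of_dvd (hirr g hg) h)
    · intro f hf
      have h1 := hν f (hirr f hf) (hdvd f hf)
      -- Modulo `f` only the term of `f` survives in `M` and in `derivative d`, so `M ≡ ν f *
      -- derivative d`.
      have h2 : f ∣ ∑ g ∈ s, (∏ j ∈ s.erase g, j) * (C (ν g : F) * derivative g)
          - C (ν f : F) * derivative d := by
        rw [hder, Finset.mul_sum, ← Finset.sum_sub_distrib]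
        refine Finset.dvd_sum fun g hg => ?_
        by_cases hgf : g = f
        · subst hgf
          convert dvd_zero _ using 1
          ring
        · have h3 : f ∣ ∏ j ∈ s.erase g, j :=
            Finset.dvd_prod_of_mem _ (Finset.mem_erase.2 ⟨Ne.symm hgf, hf⟩)
          refine dvd_sub (h3.mul_right _) ((h3.mul_right _).mul_left _)
      have h4 := dvd_add h1 (h2.mul_left (2 * p))
      convert h4 using 1
      ring

end Structure

/-- The polynomial data of an operator with eigenpolynomials of almost all degrees:
`T.p = p`, `T.q = q - 2 p η' / η`, with `deg p ≤ 2`, `deg q ≤ 1`. -/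
structure RatDiffOp2.NaturalGauge (T : RatDiffOp2) (p q η M : ℝ[X]) : Prop where
  p_eq : T.p = algebraMap ℝ[X] (RatFunc ℝ) p
  p_ne_zero : p ≠ 0
  natDegree_p : p.natDegree ≤ 2
  natDegree_q : q.natDegree ≤ 1
  eta_ne_zero : η ≠ 0
  eval_p_ne_zero : ∀ x, η.eval x = 0 → p.eval x ≠ 0
  derivative_eta : T.q.denom * derivative η = M * η
  q_eq : T.q.denom * q = T.q.num + 2 * p * M

theorem RatDiffOp2.hasEigenpolys (T : RatDiffOp2) (K : Finset ℕ) (y : ℕ → ℝ[X])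
    (hdeg : ∀ k, k ∉ K → (y k).degree = (k : WithBot ℕ))
    (heig : ∀ k, k ∉ K → T.IsEigenpoly (y k)) :
    HasEigenpolys (T.p.num * (T.q.denom * T.r.denom)) (T.q.num * (T.p.denom * T.r.denom))
      (T.r.num * (T.p.denom * T.q.denom)) (T.p.denom * (T.q.denom * T.r.denom)) K y where
  denom_ne_zero := mul_ne_zero T.p.denom_ne_zero
    (mul_ne_zero T.q.denom_ne_zero T.r.denom_ne_zero)
  degree_eq := hdeg
  eigen k hk := by
    obtain ⟨-, l, hl⟩ := heig k hk
    refine ⟨l, RatFunc.algebraMap_injective ℝ ?_⟩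
    have hp := RatFunc.algebraMap_ne_zero T.p.denom_ne_zero
    have hq := RatFunc.algebraMap_ne_zero T.q.denom_ne_zero
    have hr := RatFunc.algebraMap_ne_zero T.r.denom_ne_zero
    have ep := (div_eq_iff hp).1 (RatFunc.num_div_denom T.p)
    have eq := (div_eq_iff hq).1 (RatFunc.num_div_denom T.q)
    have er := (div_eq_iff hr).1 (RatFunc.num_div_denom T.r)
    rw [RatDiffOp2.apply] at hl
    simp only [map_add, map_mul] at hl ⊢
    rw [ep, eq, er, ← hl]
    ring

theorem RatDiffOp2.exists_naturalGauge (T : RatDiffOp2) (K : Finset ℕ) (y : ℕ → ℝ[X])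
    (hdeg : ∀ k, k ∉ K → (y k).degree = (k : WithBot ℕ))
    (heig : ∀ k, k ∉ K → T.IsEigenpoly (y k)) :
    ∃ p q η M : ℝ[X], T.NaturalGauge p q η M := by
  have H := T.hasEigenpolys K y hdeg heig
  -- Over `ℂ` every nonconstant denominator has a root at which the local analysis applies.
  have HC := H.map Complex.ofRealHom
  simp only [Polynomial.map_mul] at HC
  have hp1 : T.p.denom = 1 := by
    refine (RatFunc.monic_denom T.p).natDegree_eq_zero.1 ?_
    by_contra hne
    obtain ⟨z, hz⟩ := Complex.exists_root (f := T.p.denom.map Complex.ofRealHom)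
      (by rw [degree_map]; exact natDegree_pos_iff_degree_pos.1 (Nat.pos_of_ne_zero hne))
    have h1 := HC.eval_eq_zero_of_denom hz
    exact eval_ne_zero_of_isCoprime ((RatFunc.isCoprime_num_denom T.p).map
      (mapRingHom Complex.ofRealHom)) hz h1
  have hpe : T.p = algebraMap ℝ[X] (RatFunc ℝ) T.p.num := by
    conv_lhs => rw [← RatFunc.num_div_denom T.p, hp1, map_one, div_one]
  set p := T.p.num with hp
  have hp0 : p ≠ 0 := RatFunc.num_ne_zero T.p_ne_zero
  have hcop := RatFunc.isCoprime_num_denom T.q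
  rw [hp1] at H HC
  simp only [Polynomial.map_one, one_mul] at H HC
  set n := T.q.num
  set d := T.q.denom
  set u := T.r.denom
  have hd0 : d ≠ 0 := T.q.denom_ne_zero
  have hu0 : u ≠ 0 := T.r.denom_ne_zero
  have hres : ∀ z : ℂ, (d.map Complex.ofRealHom).eval z = 0 →
      (derivative (d.map Complex.ofRealHom)).eval z ≠ 0 ∧
      ∃ ν : ℕ, (n.map Complex.ofRealHom).eval z + 2 * ν * ((p.map Complex.ofRealHom).eval z *
        (derivative (d.map Complex.ofRealHom)).eval z) = 0 := fun z hz =>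
    HC.residue hz
      (eval_ne_zero_of_isCoprime (hcop.map (mapRingHom Complex.ofRealHom)) hz)
  have hroot : ∀ f : ℝ[X], Irreducible f → ∃ z : ℂ, (f.map Complex.ofRealHom).eval z = 0 := by
    intro f hf
    exact Complex.exists_root (f := f.map Complex.ofRealHom)
      (by rw [degree_map]; exact degree_pos_of_irreducible hf)
  have hrootd : ∀ (f : ℝ[X]) (z : ℂ), f ∣ d → (f.map Complex.ofRealHom).eval z = 0 →
      (d.map Complex.ofRealHom).eval z = 0 := fun f z hfd hz =>
    eval_eq_zero_of_dvd_of_eval_eq_zero (Polynomial.map_dvd Complex.ofRealHom hfd) hz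
  -- At a root of a repeated factor the derivative of `d` would vanish, but the zeros of `d` are
  -- simple.
  have hsq : Squarefree d := by
    rw [squarefree_iff_irreducible_sq_not_dvd_of_ne_zero hd0]
    rintro f hf ⟨g, hg⟩
    obtain ⟨z, hz⟩ := hroot f hf
    have h1 := (hres z (hrootd f z ⟨f * g, by rw [hg, mul_assoc]⟩ hz)).1
    apply h1
    rw [hg]
    simp only [Polynomial.map_mul, derivative_mul, eval_add, eval_mul, hz]
    ring
  have hν : ∀ f : ℝ[X], Irreducible f → f ∣ d →
      ∃ ν : ℕ, f ∣ n + 2 * C (ν : ℝ) * (p * derivative d) := by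
    intro f hf hfd
    obtain ⟨z, hz⟩ := hroot f hf
    obtain ⟨-, ν, hν⟩ := hres z (hrootd f z hfd hz)
    refine ⟨ν, dvd_of_irreducible_of_common_root Complex.ofRealHom hf hz ?_⟩
    rw [← hν]
    simp [derivative_map]
  obtain ⟨η, M, hη, hηd, hM, q, hq⟩ := exists_log_derivative (RatFunc.monic_denom T.q) hsq hν
  obtain ⟨hdP, hdQ⟩ := H.natDegree_le
  have hdp : p.natDegree ≤ 2 := by
    rw [natDegree_mul hp0 (mul_ne_zero hd0 hu0)] at hdP
    omega
  have hdn : n.natDegree ≤ d.natDegree + 1 := by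
    by_cases hn0 : n = 0
    · simp [hn0]
    rw [natDegree_mul X_ne_zero (mul_ne_zero hn0 hu0), natDegree_mul hn0 hu0,
      natDegree_mul hd0 hu0, natDegree_X] at hdQ
    omega
  -- From `d * η' = M * η` and `deg η' < deg η` one gets `deg M < deg d`, while `deg p ≤ 2`.
  have hdM : (2 * p * M).natDegree ≤ d.natDegree + 1 := by
    by_cases hM0 : M = 0
    · simp [hM0]
    have h1 : derivative η ≠ 0 := by
      intro h0
      rw [h0, mul_zero] at hM
      exact mul_ne_zero hM0 hη hM.symm
    have h2 := congrArg natDegree hM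
    rw [natDegree_mul hd0 h1, natDegree_mul hM0 hη] at h2
    have h3 : η.natDegree ≠ 0 := by
      intro h0
      rw [natDegree_eq_zero] at h0
      obtain ⟨c, rfl⟩ := h0
      simp at h1
    have h4 := natDegree_derivative_lt h3
    have h5 := natDegree_mul_le (p := 2 * p) (q := M)
    have h6 : (2 * p).natDegree ≤ p.natDegree := natDegree_C_mul_le 2 p
    omega
  refine ⟨p, q, η, M, hpe, hp0, hdp, ?_, hη, ?_, hM, hq.symm⟩
  · by_cases hq0 : q = 0
    · simp [hq0]
    have h1 := (natDegree_add_le n (2 * p * M)).trans (max_le hdn hdM)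
    rw [hq, natDegree_mul hd0 hq0] at h1
    omega
  -- If `p` vanished at a zero of `η`, the residue relation would make `n` vanish there together
  -- with `d`, against coprimality.
  · intro x hx hpx
    have hdx := hηd x hx
    have hev : ∀ f : ℝ[X], (f.map Complex.ofRealHom).eval (x : ℂ) = ((f.eval x : ℝ) : ℂ) := by
      intro f
      exact (eval_map _ _).trans (eval₂_at_apply _ _)
    obtain ⟨-, ν, h1⟩ := hres x (by rw [hev, hdx]; simp)
    rw [hev, hev, hpx] at h1
    simp only [Complex.ofReal_zero, zero_mul, mul_zero, add_zero] at h1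
    exact eval_ne_zero_of_isCoprime hcop hdx (by exact_mod_cast h1)

/-! ### Affine changes of variable on the line -/

section Affine

/-- The affine map `x ↦ a x + b` as a homeomorphism of the line. -/
def affineHomeo (a b : ℝ) (ha : a ≠ 0) : ℝ ≃ₜ ℝ :=
  (Homeomorph.mulLeft₀ a ha).trans (Homeomorph.addRight b)

variable {a b : ℝ} {I : Set ℝ}

theorem comp_linear_ne_zero {a : ℝ} (ha : a ≠ 0) (b : ℝ) {f : ℝ[X]} (hf : f ≠ 0) :
    f.comp (C a * X + C b) ≠ 0 := by
  intro h0
  rcases comp_eq_zero_iff.1 h0 with h1 | ⟨_, h1⟩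
  · exact hf h1
  · have := natDegree_linear (b := b) ha
    rw [h1, natDegree_C] at this
    exact zero_ne_one this

theorem isOpen_preimage_affine (hI : IsOpen I) : IsOpen {x | a * x + b ∈ I} :=
  hI.preimage (by fun_prop)

theorem ordConnected_preimage_affine (hI : I.OrdConnected) (a b : ℝ) :
    {x | a * x + b ∈ I}.OrdConnected := by
  rw [← convex_iff_ordConnected] at hI ⊢
  intro x hx y hy s t hs ht hst
  have h := hI hx hy hs ht hst
  simp only [smul_eq_mul, Set.mem_ofPred_eq] at h ⊢
  convert h using 1
  linear_combination (-b) * hst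

theorem tendsto_affine_nhdsWithin {g : ℝ → ℝ} {e : ℝ} {l : Filter ℝ}
    (h : Tendsto g (𝓝[I] (a * e + b)) l) :
    Tendsto (fun x => g (a * x + b)) (𝓝[{x | a * x + b ∈ I}] e) l := by
  refine h.comp (tendsto_nhdsWithin_iff.2 ⟨?_, eventually_mem_nhdsWithin⟩)
  have : ContinuousAt (fun x : ℝ => a * x + b) e := by fun_prop
  exact this.tendsto.mono_left nhdsWithin_le_nhds

theorem nonempty_preimage_affine (ha : a ≠ 0) (hI : I.Nonempty) : {x | a * x + b ∈ I}.Nonempty := by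
  obtain ⟨z, hz⟩ := hI
  refine ⟨(z - b) / a, ?_⟩
  have : a * ((z - b) / a) + b = z := by field_simp; ring
  rwa [Set.mem_ofPred_eq, this]

theorem frontier_preimage_affine (ha : a ≠ 0) {e : ℝ} (he : e ∈ frontier {x | a * x + b ∈ I}) :
    a * e + b ∈ frontier I := by
  have h := (affineHomeo a b ha).preimage_frontier I
  have h' : e ∈ (affineHomeo a b ha) ⁻¹' frontier I := by rw [h]; exact he
  exact h'

theorem tendsto_affine_cocompact (ha : a ≠ 0) {g : ℝ → ℝ} {l : Filter ℝ}
    (h : Tendsto g (cocompact ℝ ⊓ 𝓟 I) l) :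
    Tendsto (fun x => g (a * x + b)) (cocompact ℝ ⊓ 𝓟 {x | a * x + b ∈ I}) l := by
  refine h.comp (tendsto_inf.2 ⟨?_, ?_⟩)
  · exact ((affineHomeo a b ha).isClosedEmbedding.tendsto_cocompact).mono_left inf_le_left
  · rw [tendsto_principal]
    exact eventually_inf_principal.2 (Eventually.of_forall fun x hx => hx)

theorem integrableOn_comp_affine (ha : a ≠ 0) {g : ℝ → ℝ} (hI : IsOpen I) (hg : IntegrableOn g I) :
    IntegrableOn (fun x => g (a * x + b)) {x | a * x + b ∈ I} := by
  rw [← integrable_indicator_iff hI.measurableSet] at hg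
  rw [← integrable_indicator_iff (isOpen_preimage_affine hI).measurableSet]
  have h := (hg.comp_add_right b).comp_mul_left' ha
  exact h

end Affine

/-! ### First-order linear equations on an interval -/

section Calculus

theorem eqOn_const_of_hasDerivAt_zero {I : Set ℝ} (hI : IsOpen I) (hc : I.OrdConnected)
    {f : ℝ → ℝ} (hf : ∀ x ∈ I, HasDerivAt f 0 x) {x y : ℝ} (hx : x ∈ I) (hy : y ∈ I) :
    f x = f y :=
  hI.is_const_of_deriv_eq_zero hc.isPreconnected
    (fun z hz => (hf z hz).differentiableAt.differentiableWithinAt) (fun z hz => (hf z hz).deriv)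
    hx hy

/-- A positive function is determined up to a constant by its logarithmic derivative. -/
theorem exists_eq_const_mul {I : Set ℝ} (hI : IsOpen I) (hc : I.OrdConnected) (hne : I.Nonempty)
    {f g k : ℝ → ℝ} (hf : ∀ x ∈ I, HasDerivAt f (k x * f x) x)
    (hg : ∀ x ∈ I, HasDerivAt g (k x * g x) x) (hf0 : ∀ x ∈ I, 0 < f x) (hg0 : ∀ x ∈ I, 0 < g x) :
    ∃ c : ℝ, 0 < c ∧ ∀ x ∈ I, f x = c * g x := by
  obtain ⟨x₀, hx₀⟩ := hne
  refine ⟨f x₀ / g x₀, div_pos (hf0 _ hx₀) (hg0 _ hx₀), fun x hx => ?_⟩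
  have hd : ∀ x ∈ I, HasDerivAt (fun x => f x / g x) 0 x := by
    intro x hx
    refine ((hf x hx).div (hg x hx) (hg0 x hx).ne').congr_deriv ?_
    rw [div_eq_zero_iff]
    left; ring
  have h := eqOn_const_of_hasDerivAt_zero hI hc hd hx hx₀
  rw [← h, div_mul_cancel₀ _ (hg0 x hx).ne']

/-- A solution `V` of `(p V)' = q V` for which `p V` tends to zero at a regular point `e` vanishes
near `e`. -/
theorem eventually_eq_zero_of_tendsto_zero {I : Set ℝ} (hI : IsOpen I) (hc : I.OrdConnected)
    {V : ℝ → ℝ} {p q : ℝ[X]}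
    (hV : ∀ z ∈ I, HasDerivAt (fun x => p.eval x * V x) (q.eval z * V z) z)
    {e : ℝ} (he : e ∈ closure I) (hpe : p.eval e ≠ 0)
    (hlim : Tendsto (fun x => p.eval x * V x) (𝓝[I] e) (𝓝 0)) :
    ∀ᶠ x in 𝓝 e, x ∈ I → V x = 0 := by
  obtain ⟨δ, hδ, hball⟩ := Metric.eventually_nhds_iff_ball.1
    (p.continuous.continuousAt.eventually_ne hpe)
  set k : ℝ → ℝ := fun x => q.eval x / p.eval x with hk
  have hkc : ∀ x ∈ Metric.ball e δ, ContinuousAt k x := fun x hx =>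
    q.continuous.continuousAt.div p.continuous.continuousAt (hball x hx)
  have hkm : Measurable k := q.continuous.measurable.div p.continuous.measurable
  -- `exp (-H)` is an integrating factor: `p V exp (-H)` is constant on `I` near `e`, and its limit
  -- at `e` is zero.
  set H : ℝ → ℝ := fun x => ∫ t in e..x, k t with hH
  have hHd : ∀ x ∈ Metric.ball e δ, HasDerivAt H (k x) x := by
    intro x hx
    refine intervalIntegral.integral_hasDerivAt_right ?_
      hkm.stronglyMeasurable.stronglyMeasurableAtFilter (hkc x hx)
    refine ContinuousOn.intervalIntegrable fun t ht => (hkc t ?_).continuousWithinAt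
    exact (convex_ball e δ).ordConnected.uIcc_subset (Metric.mem_ball_self hδ) hx ht
  set J := I ∩ Metric.ball e δ with hJ
  have hd : ∀ x ∈ J, HasDerivAt (fun x => p.eval x * V x * Real.exp (-H x)) 0 x := by
    intro x hx
    refine ((hV x hx.1).mul (hHd x hx.2).neg.exp).congr_deriv ?_
    have := hball x hx.2
    simp only [hk]
    field_simp
    simp
  have hJo : IsOpen J := hI.inter Metric.isOpen_ball
  have hJc : J.OrdConnected := hc.inter (convex_ball e δ).ordConnected
  filter_upwards [Metric.ball_mem_nhds e hδ] with x hx hxI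
  have hNe : (𝓝[I] e).NeBot := mem_closure_iff_nhdsWithin_neBot.1 he
  have hlim2 : Tendsto (fun x => p.eval x * V x * Real.exp (-H x)) (𝓝[I] e)
      (𝓝 (0 * Real.exp (-H e))) := by
    refine hlim.mul ?_
    exact ((hHd e (Metric.mem_ball_self hδ)).continuousAt.neg.rexp).tendsto.mono_left
      nhdsWithin_le_nhds
  have hev : ∀ᶠ y in 𝓝[I] e, p.eval y * V y * Real.exp (-H y)
      = p.eval x * V x * Real.exp (-H x) := by
    filter_upwards [self_mem_nhdsWithin, nhdsWithin_le_nhds (Metric.ball_mem_nhds e hδ)]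
      with y hyI hy
    exact eqOn_const_of_hasDerivAt_zero hJo hJc hd ⟨hyI, hy⟩ ⟨hxI, hx⟩
  have h1 := tendsto_nhds_unique hlim2 ((tendsto_congr' hev).2 tendsto_const_nhds)
  rw [zero_mul] at h1
  have h2 := mul_eq_zero.1 h1.symm
  exact ((mul_eq_zero.1 (h2.resolve_right (Real.exp_ne_zero _))).resolve_left (hball x hx))

end Calculus

/-- A positive solution `V` on an open interval `I` of the Pearson equation `(p V)' = q V`,
`deg p ≤ 2`, `deg q ≤ 1`, that is integrable and satisfies the boundary conditions. -/
structure ClassicalWeight (I : Set ℝ) (V : ℝ → ℝ) (p q : ℝ[X]) : Prop where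
  isOpen : IsOpen I
  ordConnected : I.OrdConnected
  nonempty : I.Nonempty
  pos : ∀ z ∈ I, 0 < V z
  p_ne_zero : p ≠ 0
  natDegree_p : p.natDegree ≤ 2
  natDegree_q : q.natDegree ≤ 1
  hasDerivAt : ∀ z ∈ I, HasDerivAt (fun x => p.eval x * V x) (q.eval z * V z) z
  boundary_finite : ∀ f : ℝ[X], ∀ e ∈ frontier I,
    Tendsto (fun z => f.eval z * p.eval z * V z) (𝓝[I] e) (𝓝 0)
  boundary_infinite : ∀ f : ℝ[X],
    Tendsto (fun z => f.eval z * p.eval z * V z) (cocompact ℝ ⊓ 𝓟 I) (𝓝 0)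
  integrable : IntegrableOn V I

/-! ### Classification of the positive solutions of the Pearson equation -/

namespace ClassicalWeight

variable {I : Set ℝ} {V : ℝ → ℝ} {p q : ℝ[X]}

theorem affine (h : ClassicalWeight I V p q) {a : ℝ} (ha : a ≠ 0) (b : ℝ) :
    ClassicalWeight {x | a * x + b ∈ I} (fun x => V (a * x + b))
      (C (a ^ 2)⁻¹ * p.comp (C a * X + C b)) (C a⁻¹ * q.comp (C a * X + C b)) where
  isOpen := isOpen_preimage_affine h.isOpen
  ordConnected := ordConnected_preimage_affine h.ordConnected a b
  nonempty := nonempty_preimage_affine ha h.nonempty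
  pos z hz := h.pos _ hz
  p_ne_zero := mul_ne_zero (C_ne_zero.2 (inv_ne_zero (pow_ne_zero 2 ha)))
    (comp_linear_ne_zero ha b h.p_ne_zero)
  natDegree_p := by
    refine (natDegree_C_mul_le _ _).trans ?_
    rw [natDegree_comp, natDegree_linear ha, mul_one]
    exact h.natDegree_p
  natDegree_q := by
    refine (natDegree_C_mul_le _ _).trans ?_
    rw [natDegree_comp, natDegree_linear ha, mul_one]
    exact h.natDegree_q
  hasDerivAt z hz := by
    have h1 : HasDerivAt (fun x : ℝ => a * x + b) a z := by
      simpa using ((hasDerivAt_id z).const_mul a).add_const b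
    have h2 := (HasDerivAt.comp z (h.hasDerivAt _ hz) h1).const_mul (a ^ 2)⁻¹
    have h3 : (fun x => (C (a ^ 2)⁻¹ * p.comp (C a * X + C b)).eval x * V (a * x + b))
        = fun x => (a ^ 2)⁻¹ * (p.eval (a * x + b) * V (a * x + b)) := by
      ext x
      simp
      ring
    rw [h3]
    refine h2.congr_deriv ?_
    simp
    field_simp
  boundary_finite f e he := by
    -- Composing `f` with the inverse affine map gives the test polynomial in `z` that becomes `f`
    -- in `x`.
    have h1 := tendsto_affine_nhdsWithin
      (h.boundary_finite (f.comp (C a⁻¹ * X - C (a⁻¹ * b))) _ (frontier_preimage_affine ha he))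
    have h2 := h1.const_mul (a ^ 2)⁻¹
    rw [mul_zero] at h2
    refine h2.congr fun x => ?_
    have : a⁻¹ * (a * x + b) - a⁻¹ * b = x := by field_simp; ring
    simp [this]
    ring
  boundary_infinite f := by
    have h1 := tendsto_affine_cocompact (b := b) ha
      (h.boundary_infinite (f.comp (C a⁻¹ * X - C (a⁻¹ * b))))
    have h2 := h1.const_mul (a ^ 2)⁻¹
    rw [mul_zero] at h2
    refine h2.congr fun x => ?_
    have : a⁻¹ * (a * x + b) - a⁻¹ * b = x := by field_simp; ring
    simp [this]
    ring
  integrable := integrableOn_comp_affine ha h.isOpen h.integrable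

/-- Otherwise `e` is a regular point of the equation, and the boundary condition forces `V = 0`
nearby. -/
theorem eval_p_eq_zero (h : ClassicalWeight I V p q) {e : ℝ} (he : e ∈ frontier I) :
    p.eval e = 0 := by
  by_contra hne
  have hcl := frontier_subset_closure he
  have h1 := h.boundary_finite 1 e he
  simp only [eval_one, one_mul] at h1
  have h2 := eventually_eq_zero_of_tendsto_zero h.isOpen h.ordConnected h.hasDerivAt hcl hne h1
  obtain ⟨x, hx, hxI⟩ := ((mem_closure_iff_frequently.1 hcl).and_eventually h2).exists
  exact (h.pos x hx).ne' (hxI hx)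

theorem hasDerivAt_weight (h : ClassicalWeight I V p q) {z : ℝ} (hz : z ∈ I)
    (hp : p.eval z ≠ 0) :
    HasDerivAt V ((q.eval z - (derivative p).eval z) / p.eval z * V z) z := by
  have h1 := (h.hasDerivAt z hz).div (p.hasDerivAt z) hp
  have h2 : V =ᶠ[𝓝 z] fun x => p.eval x * V x / p.eval x := by
    filter_upwards [p.continuous.continuousAt.eventually_ne hp] with x hx
    field_simp
  refine HasDerivAt.congr_of_eventuallyEq ?_ h2
  refine h1.congr_deriv ?_
  have := hp
  field_simp

/-- The sign of this expression is that of the derivative of `(z ^ A * p V) ^ 2` for `z > 0`. An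
eventually positive, nondecreasing function cannot tend to `0`, as the decay condition demands.
Squaring makes the sign of `p` irrelevant. -/
theorem not_eventually_nonneg (h : ClassicalWeight I V p q) {m : ℝ} (hm : Set.Ioi m ⊆ I) (A : ℕ) :
    ¬ ∀ᶠ z in atTop, 0 ≤ A * p.eval z ^ 2 + z * q.eval z * p.eval z := by
  intro hA
  have hp : ∀ᶠ z in atTop, p.eval z ≠ 0 := by
    have := p.eventually_atTop_not_isRoot h.p_ne_zero
    exact this
  obtain ⟨N, hN⟩ := eventually_atTop.1
    (hA.and (hp.and ((eventually_gt_atTop m).and (eventually_gt_atTop 0))))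
  set g : ℝ → ℝ := fun z => (z ^ A * (p.eval z * V z)) ^ 2 with hg
  have hd : ∀ z, N ≤ z → HasDerivAt g (2 * (z ^ A * (p.eval z * V z)) *
      (A * z ^ (A - 1) * (p.eval z * V z) + z ^ A * (q.eval z * V z))) z := by
    intro z hz
    refine ((((hasDerivAt_pow A z).mul (h.hasDerivAt z (hm (hN z hz).2.2.1)))).pow 2).congr_deriv ?_
    norm_num
  have hmono : MonotoneOn g (Set.Ici N) := by
    refine monotoneOn_of_deriv_nonneg (convex_Ici N)
      (fun z hz => (hd z hz).continuousAt.continuousWithinAt)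
      (fun z hz => (hd z (interior_subset hz)).differentiableAt.differentiableWithinAt) ?_
    intro z hz
    have hz' : N ≤ z := interior_subset hz
    obtain ⟨h1, h2, h3, h4⟩ := hN z hz'
    rw [(hd z hz').deriv]
    have h5 : z * (2 * (z ^ A * (p.eval z * V z)) *
      (A * z ^ (A - 1) * (p.eval z * V z) + z ^ A * (q.eval z * V z)))
      = 2 * (z ^ A * V z) ^ 2 * (A * p.eval z ^ 2 + z * q.eval z * p.eval z) := by
      rcases Nat.eq_zero_or_pos A with h0 | h0
      · subst h0; simp; ring
      · have : z ^ A = z * z ^ (A - 1) := by rw [← pow_succ']; congr 1; omega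
        rw [this]; ring
    refine nonneg_of_mul_nonneg_right ?_ h4
    rw [h5]
    positivity
  have hlim : Tendsto g atTop (𝓝 0) := by
    have h1 : Tendsto (fun z => (X ^ A : ℝ[X]).eval z * p.eval z * V z) atTop (𝓝 0) := by
      refine (h.boundary_infinite (X ^ A)).mono_left (le_inf atTop_le_cocompact ?_)
      exact le_principal_iff.2 (mem_of_superset (Ioi_mem_atTop m) hm)
    have h2 := h1.pow 2
    norm_num at h2
    refine h2.congr fun z => ?_
    simp only [hg]
    ring
  obtain ⟨-, h2, h3, h4⟩ := hN N le_rfl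
  have hpos : 0 < g N := by
    have := h.pos N (hm h3)
    simp only [hg]
    positivity
  have := ge_of_tendsto hlim (eventually_ge_atTop N |>.mono fun z hz =>
    hmono (Set.mem_Ici.2 le_rfl) (Set.mem_Ici.2 hz) hz)
  linarith

/-- If `deg (z q) ≤ deg p`, then `|z q| ≤ A |p|` eventually for some natural `A`, which
`not_eventually_nonneg` excludes. If the product of leading coefficients were positive, `z q p`
would be eventually nonnegative, excluded with `A = 0`. -/
theorem of_Ioi_subset (h : ClassicalWeight I V p q) {m : ℝ} (hm : Set.Ioi m ⊆ I) :
    p.natDegree ≤ q.natDegree ∧ p.leadingCoeff * q.leadingCoeff < 0 := by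
  have hdeg : p.degree < (X * q).degree := by
    by_contra! hle
    obtain ⟨B, hB⟩ := (Polynomial.isBigO_atTop_of_degree_le _ _ hle).bound
    obtain ⟨A, hAB⟩ := exists_nat_ge B
    refine h.not_eventually_nonneg hm A ?_
    filter_upwards [hB] with z hz
    rw [eval_mul, eval_X, Real.norm_eq_abs, Real.norm_eq_abs] at hz
    have h1 : |z * q.eval z * p.eval z| ≤ A * p.eval z ^ 2 := by
      rw [abs_mul, ← sq_abs (p.eval z), pow_two, ← mul_assoc]
      refine mul_le_mul_of_nonneg_right (hz.trans ?_) (abs_nonneg _)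
      exact mul_le_mul_of_nonneg_right hAB (abs_nonneg _)
    linarith [neg_abs_le (z * q.eval z * p.eval z)]
  have hq : q ≠ 0 := by rintro rfl; simp at hdeg
  have hnat : p.natDegree ≤ q.natDegree := by
    have := natDegree_lt_natDegree h.p_ne_zero hdeg
    rw [natDegree_mul X_ne_zero hq, natDegree_X] at this
    omega
  refine ⟨hnat, ?_⟩
  by_contra! hlc
  have hlc' : 0 < (X * q * p).leadingCoeff := by
    rw [leadingCoeff_mul, leadingCoeff_mul, leadingCoeff_X, one_mul, mul_comm]
    exact lt_of_le_of_ne hlc (mul_ne_zero (leadingCoeff_ne_zero.2 h.p_ne_zero)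
      (leadingCoeff_ne_zero.2 hq)).symm
  have ht := Polynomial.tendsto_atTop_of_leadingCoeff_nonneg (X * q * p) (by
    rw [← natDegree_pos_iff_degree_pos, natDegree_mul (mul_ne_zero X_ne_zero hq) h.p_ne_zero,
      natDegree_mul X_ne_zero hq, natDegree_X]
    omega) hlc'.le
  refine h.not_eventually_nonneg hm 0 ?_
  filter_upwards [ht.eventually_ge_atTop 0] with z hz
  simpa using hz

end ClassicalWeight

/-- `V` is, up to a constant, a Hermite, Laguerre or Jacobi weight on `I`. -/
def IsStandardWeight (I : Set ℝ) (V : ℝ → ℝ) : Prop :=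
  ∃ c : ℝ, 0 < c ∧
    ((I = Set.univ ∧ ∀ x, V x = c * Real.exp (-x ^ 2)) ∨
      (I = Set.Ioi 0 ∧ ∃ α : ℝ, -1 < α ∧ ∀ x ∈ I, V x = c * (x ^ α * Real.exp (-x))) ∨
      (I = Set.Ioo (-1) 1 ∧ ∃ α β : ℝ, -1 < α ∧ -1 < β ∧
        ∀ x ∈ I, V x = c * ((1 - x) ^ α * (1 + x) ^ β)))

/-- `V` is a standard weight on `I` after an affine change of variable. -/
def IsAffineStandardWeight (I : Set ℝ) (V : ℝ → ℝ) : Prop :=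
  ∃ a b : ℝ, a ≠ 0 ∧ IsStandardWeight {x | a * x + b ∈ I} (fun x => V (a * x + b))

theorem IsAffineStandardWeight.of_affine {I : Set ℝ} {V : ℝ → ℝ} {a : ℝ} (ha : a ≠ 0) {b : ℝ}
    (h : IsAffineStandardWeight {x | a * x + b ∈ I} (fun x => V (a * x + b))) :
    IsAffineStandardWeight I V := by
  obtain ⟨a', b', ha', h⟩ := h
  refine ⟨a * a', a * b' + b, mul_ne_zero ha ha', ?_⟩
  have key : ∀ x : ℝ, a * (a' * x + b') + b = a * a' * x + (a * b' + b) := fun x => by ring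
  simp only [Set.mem_ofPred_eq, key] at h
  exact h

/-- Open intervals of the line. -/
theorem eq_interval_of_isOpen {I : Set ℝ} (hI : IsOpen I) (hc : I.OrdConnected)
    (hne : I.Nonempty) : I = Set.univ ∨ (∃ m, I = Set.Ioi m) ∨ (∃ m, I = Set.Iio m) ∨
      ∃ m n, m < n ∧ I = Set.Ioo m n := by
  have hbelow : BddBelow I → ∀ x ∈ I, sInf I < x := by
    intro hb x hx
    obtain ⟨y, hy, hyI⟩ := ((eventually_nhdsWithin_of_forall (s := Set.Iio x) (a := x)
      fun y hy => hy).and (nhdsWithin_le_nhds (hI.mem_nhds hx))).exists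
    exact (csInf_le hb hyI).trans_lt hy
  have habove : BddAbove I → ∀ x ∈ I, x < sSup I := by
    intro hb x hx
    obtain ⟨y, hy, hyI⟩ := ((eventually_nhdsWithin_of_forall (s := Set.Ioi x) (a := x)
      fun y hy => hy).and (nhdsWithin_le_nhds (hI.mem_nhds hx))).exists
    exact lt_of_lt_of_le hy (le_csSup hb hyI)
  have hmem : ∀ x, (∃ y ∈ I, y < x) → (∃ y ∈ I, x < y) → x ∈ I := by
    rintro x ⟨y, hy, hyx⟩ ⟨z, hz, hxz⟩
    exact hc.out hy hz ⟨hyx.le, hxz.le⟩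
  by_cases hb : BddBelow I <;> by_cases ha : BddAbove I
  · right; right; right
    obtain ⟨x, hx⟩ := hne
    refine ⟨sInf I, sSup I, (hbelow hb x hx).trans (habove ha x hx), Set.ext fun z =>
      ⟨fun hz => ⟨hbelow hb z hz, habove ha z hz⟩, fun hz => hmem z ?_ ?_⟩⟩
    · exact exists_lt_of_csInf_lt ⟨x, hx⟩ hz.1
    · exact exists_lt_of_lt_csSup ⟨x, hx⟩ hz.2
  · right; left
    refine ⟨sInf I, Set.ext fun z => ⟨fun hz => hbelow hb z hz, fun hz => hmem z ?_ ?_⟩⟩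
    · exact exists_lt_of_csInf_lt hne hz
    · exact not_bddAbove_iff.1 ha z
  · right; right; left
    refine ⟨sSup I, Set.ext fun z => ⟨fun hz => habove ha z hz, fun hz => hmem z ?_ ?_⟩⟩
    · exact not_bddBelow_iff.1 hb z
    · exact exists_lt_of_lt_csSup hne hz
  · left
    exact Set.eq_univ_of_forall fun z =>
      hmem z (not_bddBelow_iff.1 hb z) (not_bddAbove_iff.1 ha z)

namespace ClassicalWeight

variable {V : ℝ → ℝ} {p q : ℝ[X]}

theorem hermite (h : ClassicalWeight Set.univ V p q) : IsAffineStandardWeight Set.univ V := by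
  obtain ⟨h1, h2⟩ := h.of_Ioi_subset (Set.subset_univ (Set.Ioi 0))
  -- Reflection gives the sign condition at `-∞`. Compared with that at `+∞`, it makes `deg p + deg
  -- q` odd, hence `deg p = 0` and `deg q = 1`.
  have hr := h.affine (a := -1) (by norm_num) 0
  obtain ⟨-, h4⟩ := hr.of_Ioi_subset (m := 0) (fun x _ => Set.mem_univ _)
  have hlin : (C (-1) * X + C 0 : ℝ[X]).natDegree = 1 := natDegree_linear (by norm_num)
  rw [leadingCoeff_mul, leadingCoeff_mul, leadingCoeff_C, leadingCoeff_C,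
    leadingCoeff_comp (by omega), leadingCoeff_comp (by omega),
    leadingCoeff_linear (by norm_num)] at h4
  have hq := h.natDegree_q
  have hpd : p.natDegree = 0 := by
    by_contra hne
    have e1 : p.natDegree = 1 := by omega
    have e2 : q.natDegree = 1 := by omega
    rw [e1, e2] at h4
    norm_num at h4
    linarith
  have hqd : q.natDegree = 1 := by
    by_contra hne
    have e2 : q.natDegree = 0 := by omega
    rw [hpd, e2] at h4
    norm_num at h4
    linarith
  obtain ⟨c, rfl⟩ := natDegree_eq_zero.1 hpd
  obtain ⟨u, hu, v, rfl⟩ := natDegree_eq_one.1 hqd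
  rw [leadingCoeff_C, leadingCoeff_linear hu] at h2
  have hc : c ≠ 0 := by rintro rfl; simp at h2
  -- Completing the square: `V'/V = (u z + v) / c` is `-2 A (z - m)` with `m = -v / u`.
  set A := -u / (2 * c) with hA
  have hApos : 0 < A := by
    rw [hA, div_pos_iff]
    rcases lt_or_gt_of_ne hc with h0 | h0
    · right; constructor <;> nlinarith
    · left; constructor <;> nlinarith
  set m := -v / u with hm
  obtain ⟨d, hd, hV⟩ := exists_eq_const_mul (g := fun z => Real.exp (-(A * (z - m) ^ 2)))
    (k := fun z => (u * z + v) / c) isOpen_univ Set.ordConnected_univ Set.univ_nonempty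
    (fun z hz => by simpa using h.hasDerivAt_weight hz (by simpa using hc))
    (fun z _ => by
      have := ((((hasDerivAt_id z).sub_const m).pow 2).const_mul A).neg.exp
      have e : -(A * (2 * (z - m))) = (u * z + v) / c := by
        simp only [hA, hm]
        field_simp
        ring
      refine this.congr_deriv ?_
      change Real.exp (-(A * (z - m) ^ 2)) * _ = _
      rw [← e]
      norm_num
      ring)
    h.pos (fun z _ => Real.exp_pos _)
  have hs : 0 < Real.sqrt A := Real.sqrt_pos.2 hApos
  refine ⟨1 / Real.sqrt A, m, by positivity, d, hd, Or.inl ⟨Set.eq_univ_of_forall fun _ => trivial,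
    fun x => ?_⟩⟩
  refine (hV _ trivial).trans ?_
  have : A * (1 / Real.sqrt A * x + m - m) ^ 2 = x ^ 2 := by
    have h5 := Real.sq_sqrt hApos.le
    rw [add_sub_cancel_right, mul_pow, div_pow, h5]
    field_simp
  rw [this]

theorem laguerre (h : ClassicalWeight (Set.Ioi 0) V p q) :
    IsAffineStandardWeight (Set.Ioi 0) V := by
  obtain ⟨h1, h2⟩ := h.of_Ioi_subset subset_rfl
  have hq := h.natDegree_q
  have hp0 : p.eval 0 = 0 := h.eval_p_eq_zero (by simp)
  have hpd : p.natDegree = 1 := by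
    by_contra hne
    have e1 : p.natDegree = 0 := by omega
    obtain ⟨c, rfl⟩ := natDegree_eq_zero.1 e1
    exact h.p_ne_zero (by rw [eval_C] at hp0; rw [hp0, C_0])
  obtain ⟨c, hc, c', rfl⟩ := natDegree_eq_one.1 hpd
  obtain ⟨u, hu, v, rfl⟩ := natDegree_eq_one.1 (show q.natDegree = 1 by omega)
  rw [leadingCoeff_linear hc, leadingCoeff_linear hu] at h2
  have hc' : c' = 0 := by simpa using hp0
  subst hc'
  -- With `p = c z`, `V'/V = (q - p') / p` equals `α / z - b`.
  set b := -u / c with hb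
  have hbpos : 0 < b := by
    rw [hb, div_pos_iff]
    rcases lt_or_gt_of_ne hc with h0 | h0
    · right; constructor <;> nlinarith
    · left; constructor <;> nlinarith
  set α := v / c - 1 with hα
  obtain ⟨d, hd, hV⟩ := exists_eq_const_mul (g := fun z => z ^ α * Real.exp (-(b * z)))
    (k := fun z => (u * z + v - c) / (c * z)) isOpen_Ioi Set.ordConnected_Ioi ⟨1, by simp⟩
    (fun z hz => by
      have hz' : z ≠ 0 := (Set.mem_Ioi.1 hz).ne'
      simpa using h.hasDerivAt_weight hz (by simpa using ⟨hc, hz'⟩))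
    (fun z hz => by
      have hz' : 0 < z := hz
      have := (Real.hasDerivAt_rpow_const (p := α) (Or.inl hz'.ne')).mul
        (((hasDerivAt_id z).const_mul b).neg.exp)
      have e : α / z - b = (u * z + v - c) / (c * z) := by
        simp only [hα, hb]
        field_simp
        ring
      refine this.congr_deriv ?_
      change α * z ^ (α - 1) * Real.exp (-(b * z)) + z ^ α * (Real.exp (-(b * z)) * -(b * 1)) = _
      rw [Real.rpow_sub_one hz'.ne' α, ← e]
      ring)
    h.pos (fun z hz => by have : 0 < z := hz; positivity)
  refine ⟨1 / b, 0, by positivity, d * (1 / b) ^ α, by positivity, Or.inr (Or.inl ⟨?_, α, ?_, ?_⟩)⟩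
  · ext x
    simp [hbpos]
  -- On `(0, 1)` the exponential factor is at least `exp (-b)`, so `x ^ α` is dominated by a
  -- multiple of `V`.
  · rw [← intervalIntegral.integrableOn_Ioo_rpow_iff zero_lt_one]
    have h3 : IntegrableOn V (Set.Ioo 0 1) := h.integrable.mono_set fun x hx => hx.1
    refine Integrable.mono' (h3.const_mul (Real.exp b / d)) ?_ ?_
    · exact (measurable_id.pow_const α).aestronglyMeasurable
    · refine (ae_restrict_iff' measurableSet_Ioo).2 (ae_of_all _ fun x hx => ?_)
      have hx0 : 0 < x := hx.1
      rw [hV x hx0, Real.norm_of_nonneg (by positivity)]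
      have h4 : 1 ≤ Real.exp b * Real.exp (-(b * x)) := by
        rw [← Real.exp_add, Real.one_le_exp_iff]
        nlinarith [hx.2]
      have h5 : Real.exp b / d * (d * (x ^ α * Real.exp (-(b * x))))
          = x ^ α * (Real.exp b * Real.exp (-(b * x))) := by field_simp
      rw [h5]
      exact le_mul_of_one_le_right (by positivity) h4
  · intro x hx
    have hx0 : 0 < 1 / b * x := by simpa using hx
    have hx1 : 0 < x := pos_of_mul_pos_right hx0 (by positivity)
    have h6 : b * (1 / b * x) = x := by field_simp
    simp only [add_zero]
    rw [hV _ hx0, Real.mul_rpow (by positivity) hx1.le, h6]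
    ring

theorem jacobi (h : ClassicalWeight (Set.Ioo (-1) 1) V p q) :
    IsStandardWeight (Set.Ioo (-1) 1) V := by
  have hf : frontier (Set.Ioo (-1 : ℝ) 1) = {-1, 1} := frontier_Ioo (by norm_num)
  have hp1 : p.eval 1 = 0 := h.eval_p_eq_zero (by simp [hf])
  have hp2 : p.eval (-1) = 0 := h.eval_p_eq_zero (by simp [hf])
  obtain ⟨c, hc, hpc⟩ : ∃ c : ℝ, c ≠ 0 ∧ p = C c * (1 - X ^ 2) := by
    have hd := h.natDegree_p
    have e := p.as_sum_range_C_mul_X_pow' (n := 3) (by omega)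
    simp only [Finset.sum_range_succ, Finset.sum_range_zero] at e
    have e1 := hp1
    have e2 := hp2
    rw [e] at e1 e2
    simp at e1 e2
    have e3 : p.coeff 1 = 0 := by linarith
    have e4 : p.coeff 0 = -p.coeff 2 := by linarith
    have e5 : p = C (-p.coeff 2) * (1 - X ^ 2) := by
      conv_lhs => rw [e, e3, e4]
      simp
      ring
    refine ⟨-p.coeff 2, ?_, e5⟩
    intro h0
    rw [h0, C_0, zero_mul] at e5
    exact h.p_ne_zero e5
  obtain ⟨u, v, rfl⟩ := exists_eq_X_add_C_of_natDegree_le_one h.natDegree_q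
  subst hpc
  -- The exponents come from the partial fractions `V'/V = -α / (1 - z) + β / (1 + z)`.
  set α := -(u + v) / (2 * c) - 1 with hα
  set β := (v - u) / (2 * c) - 1 with hβ
  obtain ⟨d, hd, hV⟩ := exists_eq_const_mul (g := fun z => (1 - z) ^ α * (1 + z) ^ β)
    (k := fun z => (u * z + v + 2 * c * z) / (c * (1 - z ^ 2))) isOpen_Ioo Set.ordConnected_Ioo
    ⟨0, by simp⟩
    (fun z hz => by
      have hz1 : 0 < 1 - z := by linarith [hz.2]
      have hz2 : 0 < 1 + z := by linarith [hz.1]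
      have hz3 : 1 - z ^ 2 ≠ 0 := by nlinarith
      refine (h.hasDerivAt_weight hz (by simpa using ⟨hc, hz3⟩)).congr_deriv ?_
      simp
      left
      ring)
    (fun z hz => by
      have hz1 : 0 < 1 - z := by linarith [hz.2]
      have hz2 : 0 < 1 + z := by linarith [hz.1]
      have := (((hasDerivAt_id z).const_sub 1).rpow_const (p := α) (Or.inl hz1.ne')).mul
        (((hasDerivAt_id z).const_add 1).rpow_const (p := β) (Or.inl hz2.ne'))
      have e : -α / (1 - z) + β / (1 + z) = (u * z + v + 2 * c * z) / (c * (1 - z ^ 2)) := by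
        have e' : 1 - z ^ 2 = (1 - z) * (1 + z) := by ring
        rw [e']
        simp only [hα, hβ]
        field_simp
        ring
      refine this.congr_deriv ?_
      simp only [id]
      rw [Real.rpow_sub_one hz1.ne' α, Real.rpow_sub_one hz2.ne' β, ← e]
      ring)
    h.pos (fun z hz => by
      have hz1 : 0 < 1 - z := by linarith [hz.2]
      have hz2 : 0 < 1 + z := by linarith [hz.1]
      positivity)
  -- Here `x` is the distance to one endpoint. The factor `(2 - x) ^ b` of the other endpoint is
  -- bounded below on `(0, 1)`, so `x ^ a` is integrable there.
  have key : ∀ (a b : ℝ) (f : ℝ → ℝ), IntegrableOn f (Set.Ioo 0 1) →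
      (∀ x ∈ Set.Ioo (0 : ℝ) 1, f x = d * (x ^ a * (2 - x) ^ b)) → -1 < a := by
    intro a b f hf hfx
    rw [← intervalIntegral.integrableOn_Ioo_rpow_iff zero_lt_one]
    obtain ⟨B, hB0, hB⟩ : ∃ B : ℝ, 0 < B ∧ ∀ x ∈ Set.Ioo (0 : ℝ) 1, B ≤ (2 - x) ^ b := by
      rcases le_total 0 b with hb | hb
      · refine ⟨1, one_pos, fun x hx => Real.one_le_rpow (by linarith [hx.2]) hb⟩
      · refine ⟨2 ^ b, by positivity, fun x hx => ?_⟩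
        exact Real.rpow_le_rpow_of_nonpos (by linarith [hx.2]) (by linarith [hx.1]) hb
    refine Integrable.mono' (hf.const_mul (1 / (d * B))) ?_ ?_
    · exact (measurable_id.pow_const a).aestronglyMeasurable
    · refine (ae_restrict_iff' measurableSet_Ioo).2 (ae_of_all _ fun x hx => ?_)
      have hx0 : 0 < x := hx.1
      rw [hfx x hx, Real.norm_of_nonneg (by positivity)]
      have h5 : 1 / (d * B) * (d * (x ^ a * (2 - x) ^ b)) = x ^ a * ((2 - x) ^ b / B) := by
        field_simp
      rw [h5]
      exact le_mul_of_one_le_right (by positivity) ((one_le_div hB0).2 (hB x hx))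
  refine ⟨d, hd, Or.inr (Or.inr ⟨rfl, α, β, ?_, ?_, hV⟩)⟩
  · refine key α β (fun x => V (-1 * x + 1)) ?_ ?_
    · refine (integrableOn_comp_affine (by norm_num) isOpen_Ioo h.integrable).mono_set ?_
      intro x hx
      exact ⟨by linarith [hx.2], by linarith [hx.1]⟩
    · intro x hx
      rw [hV _ ⟨by linarith [hx.2], by linarith [hx.1]⟩]
      ring_nf
  · refine key β α (fun x => V (1 * x + -1)) ?_ ?_
    · refine (integrableOn_comp_affine (by norm_num) isOpen_Ioo h.integrable).mono_set ?_
      intro x hx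
      exact ⟨by linarith [hx.1], by linarith [hx.2]⟩
    · intro x hx
      rw [hV _ ⟨by linarith [hx.1], by linarith [hx.2]⟩]
      ring_nf

theorem isAffineStandardWeight {I : Set ℝ} (h : ClassicalWeight I V p q) :
    IsAffineStandardWeight I V := by
  rcases eq_interval_of_isOpen h.isOpen h.ordConnected h.nonempty with
    rfl | ⟨m, rfl⟩ | ⟨m, rfl⟩ | ⟨m, n, hmn, rfl⟩
  · exact h.hermite
  · refine IsAffineStandardWeight.of_affine one_ne_zero (b := m) ?_
    have h1 := h.affine one_ne_zero m
    have e : {x : ℝ | 1 * x + m ∈ Set.Ioi m} = Set.Ioi 0 := by ext x; simp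
    rw [e] at h1 ⊢
    exact h1.laguerre
  · refine IsAffineStandardWeight.of_affine (a := -1) (by norm_num) (b := m) ?_
    have h1 := h.affine (a := -1) (by norm_num) m
    have e : {x : ℝ | -1 * x + m ∈ Set.Iio m} = Set.Ioi 0 := by ext x; simp
    rw [e] at h1 ⊢
    exact h1.laguerre
  · have ha : (n - m) / 2 ≠ 0 := by
      have : 0 < n - m := by linarith
      positivity
    have h1 := h.affine ha ((m + n) / 2)
    have e : {x : ℝ | (n - m) / 2 * x + (m + n) / 2 ∈ Set.Ioo m n} = Set.Ioo (-1) 1 := by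
      ext x
      constructor
      · rintro ⟨hx1, hx2⟩
        constructor <;> nlinarith
      · rintro ⟨hx1, hx2⟩
        constructor <;> nlinarith
    refine ⟨(n - m) / 2, (m + n) / 2, ha, ?_⟩
    rw [e] at h1 ⊢
    exact h1.jacobi

end ClassicalWeight

/-! ### Values of rational functions and affine substitution in operators -/

section RatEval

theorem ratEval_eq_div (f : RatFunc ℝ) (x : ℝ) :
    ratEval f x = f.num.eval x / f.denom.eval x := by
  rw [ratEval, RatFunc.eval, eval₂_id, eval₂_id]

/-- Two coprime fractions with the same value have the same zeros above and below, by
cross-multiplication. At a pole both quotients are `0` by the convention for division by zero. -/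
theorem ratEval_div {g : RatFunc ℝ} {n d : ℝ[X]} (hd : d ≠ 0) (hcop : IsCoprime n d)
    (hg : g = algebraMap ℝ[X] (RatFunc ℝ) n / algebraMap ℝ[X] (RatFunc ℝ) d) (x : ℝ) :
    (g.denom.eval x = 0 ↔ d.eval x = 0) ∧ (g.num.eval x = 0 ↔ n.eval x = 0) ∧
      ratEval g x = n.eval x / d.eval x := by
  have h := congrArg (eval x) ((RatFunc.num_mul_eq_mul_denom_iff hd).2 hg)
  rw [eval_mul, eval_mul] at h
  have hgc := g.isCoprime_num_denom
  have h1 : g.denom.eval x = 0 ↔ d.eval x = 0 := by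
    constructor
    · intro h0
      have := eval_ne_zero_of_isCoprime hgc h0
      rw [h0, mul_zero] at h
      exact (mul_eq_zero.1 h).resolve_left this
    · intro h0
      have := eval_ne_zero_of_isCoprime hcop h0
      rw [h0, mul_zero] at h
      exact (mul_eq_zero.1 h.symm).resolve_left this
  refine ⟨h1, ?_, ?_⟩
  · constructor
    · intro h0
      have := eval_ne_zero_of_isCoprime hgc.symm h0
      rw [h0, zero_mul] at h
      exact (mul_eq_zero.1 h.symm).resolve_right this
    · intro h0
      have := eval_ne_zero_of_isCoprime hcop.symm h0
      rw [h0, zero_mul] at h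
      exact (mul_eq_zero.1 h).resolve_right this
  · rw [ratEval_eq_div]
    by_cases h0 : d.eval x = 0
    · rw [h0, h1.2 h0, div_zero, div_zero]
    · rw [div_eq_div_iff (fun h' => h0 (h1.1 h')) h0, h]

theorem degree_comp_linear {a : ℝ} (ha : a ≠ 0) (b : ℝ) (f : ℝ[X]) :
    (f.comp (C a * X + C b)).degree = f.degree := by
  by_cases hf : f = 0
  · simp [hf]
  · rw [degree_eq_natDegree (comp_linear_ne_zero ha b hf), degree_eq_natDegree hf, natDegree_comp,
      natDegree_linear ha, mul_one]

theorem ratEval_C_mul_ratCompAffine {a c : ℝ} (ha : a ≠ 0) (b : ℝ) (hc : c ≠ 0) (f : RatFunc ℝ)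
    (x : ℝ) :
    ((RatFunc.C c * ratCompAffine a b f).denom.eval x = 0 ↔ f.denom.eval (a * x + b) = 0) ∧
      ((RatFunc.C c * ratCompAffine a b f).num.eval x = 0 ↔ f.num.eval (a * x + b) = 0) ∧
      ratEval (RatFunc.C c * ratCompAffine a b f) x = c * ratEval f (a * x + b) := by
  have hcop : IsCoprime (C c * f.num.comp (C a * X + C b)) (f.denom.comp (C a * X + C b)) := by
    have h1 := f.isCoprime_num_denom.map (compRingHom (C a * X + C b))
    refine (isCoprime_mul_unit_left_left ?_ _ _).2 h1
    exact isUnit_C.2 hc.isUnit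
  have h := ratEval_div (comp_linear_ne_zero ha b f.denom_ne_zero) hcop
    (g := RatFunc.C c * ratCompAffine a b f)
    (by rw [ratCompAffine, map_mul, RatFunc.algebraMap_C, mul_div_assoc]) x
  simp only [eval_comp, eval_mul, eval_C, eval_add, eval_X, mul_eq_zero, hc, false_or] at h
  rw [ratEval_eq_div f, ← mul_div_assoc]
  exact h

end RatEval

section AffineOperator

theorem comp_linear_injective {a : ℝ} (ha : a ≠ 0) (b : ℝ) :
    Function.Injective (compRingHom (C a * X + C b : ℝ[X])) :=
  (injective_iff_map_eq_zero _).2 fun f h => by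
    by_contra hf
    exact comp_linear_ne_zero ha b hf h

/-- The substitution `z = a x + b` in rational functions. -/
def ratCompAffineHom (a b : ℝ) (ha : a ≠ 0) : RatFunc ℝ →+* RatFunc ℝ :=
  RatFunc.mapRingHom (compRingHom (C a * X + C b : ℝ[X]))
    (nonZeroDivisors_le_comap_nonZeroDivisors_of_injective _ (comp_linear_injective ha b))

theorem ratCompAffineHom_apply (a b : ℝ) (ha : a ≠ 0) (f : RatFunc ℝ) :
    ratCompAffineHom a b ha f = ratCompAffine a b f := by
  rw [ratCompAffineHom, RatFunc.coe_mapRingHom_eq_coe_map, RatFunc.map_apply]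
  rfl

theorem ratCompAffineHom_algebraMap (a b : ℝ) (ha : a ≠ 0) (f : ℝ[X]) :
    ratCompAffineHom a b ha (algebraMap ℝ[X] (RatFunc ℝ) f)
      = algebraMap ℝ[X] (RatFunc ℝ) (f.comp (C a * X + C b)) := by
  have h := RatFunc.map_apply_div (compRingHom (C a * X + C b : ℝ[X]))
    (nonZeroDivisors_le_comap_nonZeroDivisors_of_injective _ (comp_linear_injective ha b)) f 1
  rw [map_one, div_one, map_one, map_one, div_one] at h
  exact h

/-- Chain rule: each derivative of the composite brings a factor `a`, cancelled by the scalings of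
`p` and `q` in `affine`. -/
theorem RatDiffOp2.affine_apply_comp (T : RatDiffOp2) {a : ℝ} (ha : a ≠ 0) (b : ℝ) (f : ℝ[X]) :
    (T.affine a b ha).apply (f.comp (C a * X + C b)) = ratCompAffineHom a b ha (T.apply f) := by
  have hL : derivative (C a * X + C b : ℝ[X]) = C a := by simp
  simp only [RatDiffOp2.apply, RatDiffOp2.affine, map_add, map_mul, derivative_comp, hL,
    derivative_mul, derivative_C, zero_mul, zero_add, ← ratCompAffineHom_apply a b ha,
    ratCompAffineHom_algebraMap, RatFunc.algebraMap_C]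
  have h1 : RatFunc.C (a ^ 2)⁻¹ * (RatFunc.C a * RatFunc.C a) = 1 := by
    rw [← map_mul, ← map_mul, ← map_one RatFunc.C]
    congr 1
    field_simp
  have h2 : RatFunc.C a⁻¹ * RatFunc.C a = 1 := by
    rw [← map_mul, ← map_one RatFunc.C, inv_mul_cancel₀ ha]
  linear_combination
    ratCompAffineHom a b ha T.p * algebraMap ℝ[X] (RatFunc ℝ)
      ((derivative (derivative f)).comp (C a * X + C b)) * h1 +
    ratCompAffineHom a b ha T.q * algebraMap ℝ[X] (RatFunc ℝ)
      ((derivative f).comp (C a * X + C b)) * h2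

theorem RatDiffOp2.isEigenpoly_affine (T : RatDiffOp2) {a : ℝ} (ha : a ≠ 0) (b : ℝ) (f : ℝ[X]) :
    (T.affine a b ha).IsEigenpoly (f.comp (C a * X + C b)) ↔ T.IsEigenpoly f := by
  rw [RatDiffOp2.IsEigenpoly, RatDiffOp2.IsEigenpoly]
  refine and_congr ⟨fun h h0 => h (by rw [h0, zero_comp]), comp_linear_ne_zero ha b⟩
    (exists_congr fun l => ?_)
  rw [T.affine_apply_comp ha b f]
  have : C l * f.comp (C a * X + C b) = (C l * f).comp (C a * X + C b) := by simp
  rw [this, ← ratCompAffineHom_algebraMap a b ha]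
  exact (ratCompAffineHom a b ha).injective.eq_iff

theorem RatDiffOp2.IsWeightOn.affine {T : RatDiffOp2} {W : ℝ → ℝ} {I : Set ℝ}
    (h : T.IsWeightOn W I) {a : ℝ} (ha : a ≠ 0) (b : ℝ) :
    (T.affine a b ha).IsWeightOn (fun x => W (a * x + b)) {x | a * x + b ∈ I} where
  pos z hz := h.pos _ hz
  continuousOn := h.continuousOn.comp (by fun_prop) fun x hx => hx
  hasDerivAt z hz h1 h2 h3 := by
    have e1 := ratEval_C_mul_ratCompAffine ha b (inv_ne_zero (pow_ne_zero 2 ha)) T.p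
    have e2 := ratEval_C_mul_ratCompAffine ha b (inv_ne_zero ha) T.q
    have h4 := h.hasDerivAt _ hz (fun h0 => h1 ((e1 z).1.2 h0)) (fun h0 => h2 ((e2 z).1.2 h0))
      (fun h0 => h3 ((e1 z).2.1.2 h0))
    have h5 : HasDerivAt (fun x : ℝ => a * x + b) a z := by
      simpa using ((hasDerivAt_id z).const_mul a).add_const b
    have h6 := (HasDerivAt.comp z h4 h5).const_mul (a ^ 2)⁻¹
    have h7 : (fun x => ratEval (T.affine a b ha).p x * W (a * x + b))
        = fun x => (a ^ 2)⁻¹ * (ratEval T.p (a * x + b) * W (a * x + b)) := by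
      ext x
      rw [← mul_assoc, ← (e1 x).2.2]
      rfl
    rw [h7]
    refine h6.congr_deriv ?_
    have h8 : ratEval (T.affine a b ha).q z = a⁻¹ * ratEval T.q (a * z + b) := (e2 z).2.2
    rw [h8]
    field_simp

end AffineOperator

/-! ### Affine invariance of SL-OPS -/

namespace SLData

theorem smul_map_measure_affine (S : SLData) {a : ℝ} (ha : a ≠ 0)
    (b : ℝ) :
    ENNReal.ofReal |a| • (S.affine a b ha).measure.map (affineHomeo a b ha).toMeasurableEquiv
      = S.measure := by
  set e := (affineHomeo a b ha).toMeasurableEquiv with he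
  have hvol : ENNReal.ofReal |a| • (volume : Measure ℝ).map e = volume := by
    have h1 : (e : ℝ → ℝ) = (fun x => x + b) ∘ (fun x => a * x) := rfl
    rw [h1, ← Measure.map_map (by fun_prop) (by fun_prop), ← Measure.map_smul,
      Real.smul_map_volume_mul_left ha, map_add_right_eq_self]
  ext s hs
  have hpre : MeasurableSet (e ⁻¹' s) := e.measurable hs
  rw [Measure.smul_apply, Measure.map_apply e.measurable hs, measure, measure,
    withDensity_apply _ hpre, withDensity_apply _ hs, Measure.restrict_restrict hpre,
    Measure.restrict_restrict hs]
  have h2 : e ⁻¹' s ∩ (S.affine a b ha).I = e ⁻¹' (s ∩ S.I) := rfl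
  have h3 : (fun z => ENNReal.ofReal ((S.affine a b ha).W z))
      = fun z => (fun y => ENNReal.ofReal (S.W y)) (e z) := rfl
  rw [h2, h3]
  conv_rhs => rw [← hvol]
  rw [Measure.restrict_smul, lintegral_smul_measure, e.measurableEmbedding.restrict_map,
    e.measurableEmbedding.lintegral_map]

theorem comp_mem_polySpan_affine (S : SLData) {a : ℝ} (ha : a ≠ 0) (b : ℝ) {g : ℝ[X]}
    (hg : g ∈ S.polySpan) : g.comp (C a * X + C b) ∈ (S.affine a b ha).polySpan := by
  induction hg using Submodule.span_induction with
  | mem f hf =>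
    obtain ⟨k, hk, rfl⟩ := hf
    exact Submodule.subset_span ⟨k, hk, rfl⟩
  | zero => rw [zero_comp]; exact Submodule.zero_mem _
  | add f g _ _ hf hg => rw [add_comp]; exact Submodule.add_mem _ hf hg
  | smul c f _ hf => rw [smul_comp]; exact Submodule.smul_mem _ c hf

theorem integrableOn_eval_mul {W : ℝ → ℝ} {I : Set ℝ}
    (h : ∀ j : ℕ, IntegrableOn (fun z => z ^ j * W z) I) (f : ℝ[X]) :
    IntegrableOn (fun z => f.eval z * W z) I := by
  induction f using Polynomial.induction_on' with
  | add f g hf hg =>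
    simp only [eval_add, add_mul]
    exact hf.add hg
  | monomial n c =>
    simp only [eval_monomial, mul_assoc]
    exact (h n).const_mul c

theorem IsSLOPS.affine {S : SLData} (h : S.IsSLOPS) {a : ℝ} (ha : a ≠ 0) (b : ℝ) :
    (S.affine a b ha).IsSLOPS where
  degree_y k hk := (degree_comp_linear ha b _).trans (h.degree_y k hk)
  eigen k hk := (S.T.isEigenpoly_affine ha b _).2 (h.eigen k hk)
  gap k hk f hf hfe := by
    have hinv : ((C a⁻¹ * X + C (-(a⁻¹ * b))).comp (C a * X + C b) : ℝ[X]) = X := by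
      have h1 : (C a⁻¹ * C a : ℝ[X]) = 1 := by rw [← C_mul, inv_mul_cancel₀ ha, C_1]
      simp only [add_comp, mul_comp, C_comp, X_comp]
      rw [C_neg, C_mul]
      linear_combination X * h1
    -- Every polynomial in `x` comes from one in `z` of the same degree, so a forbidden
    -- eigenpolynomial would pull back to one of `S.T`.
    have hf' : f = (f.comp (C a⁻¹ * X + C (-(a⁻¹ * b)))).comp (C a * X + C b) := by
      rw [comp_assoc, hinv, comp_X]
    rw [hf'] at hfe
    refine h.gap k hk _ ?_ ((S.T.isEigenpoly_affine ha b _).1 hfe)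
    rw [degree_comp_linear (inv_ne_zero ha), hf]
  isOpen_I := isOpen_preimage_affine h.isOpen_I
  ordConnected_I := ordConnected_preimage_affine h.ordConnected_I a b
  nonempty_I := nonempty_preimage_affine ha h.nonempty_I
  weight := h.weight.affine ha b
  integrable := integrableOn_comp_affine ha h.isOpen_I h.integrable
  moments j := by
    have h1 := integrableOn_comp_affine (b := b) ha h.isOpen_I
      (integrableOn_eval_mul h.moments ((C a⁻¹ * X - C (a⁻¹ * b)) ^ j))
    refine h1.congr_fun (fun x _ => ?_) (isOpen_preimage_affine h.isOpen_I).measurableSet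
    have : a⁻¹ * (a * x + b) - a⁻¹ * b = x := by field_simp; ring
    simp [this, SLData.affine]
  boundary_finite f e he := by
    have h1 := tendsto_affine_nhdsWithin
      (h.boundary_finite (f.comp (C a⁻¹ * X - C (a⁻¹ * b))) _ (frontier_preimage_affine ha he))
    have h2 := h1.const_mul (a ^ 2)⁻¹
    rw [mul_zero] at h2
    refine h2.congr fun x => ?_
    have h3 : ratEval (S.affine a b ha).T.p x = (a ^ 2)⁻¹ * ratEval S.T.p (a * x + b) :=
      (ratEval_C_mul_ratCompAffine ha b (inv_ne_zero (pow_ne_zero 2 ha)) S.T.p x).2.2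
    have : a⁻¹ * (a * x + b) - a⁻¹ * b = x := by field_simp; ring
    rw [h3]
    simp [this, SLData.affine]
    ring
  boundary_infinite f := by
    have h1 := tendsto_affine_cocompact (b := b) ha
      (h.boundary_infinite (f.comp (C a⁻¹ * X - C (a⁻¹ * b))))
    have h2 := h1.const_mul (a ^ 2)⁻¹
    rw [mul_zero] at h2
    refine h2.congr fun x => ?_
    have h3 : ratEval (S.affine a b ha).T.p x = (a ^ 2)⁻¹ * ratEval S.T.p (a * x + b) :=
      (ratEval_C_mul_ratCompAffine ha b (inv_ne_zero (pow_ne_zero 2 ha)) S.T.p x).2.2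
    have : a⁻¹ * (a * x + b) - a⁻¹ * b = x := by field_simp; ring
    rw [h3]
    simp [this, SLData.affine]
    ring
  dense f hf ε hε := by
    set e := (affineHomeo a b ha).toMeasurableEquiv with he
    have hmap := S.smul_map_measure_affine ha b
    have ha' : 0 < |a| := abs_pos.2 ha
    have hc : ENNReal.ofReal |a| ≠ 0 := by simpa using ha
    have hf' : MemLp (f ∘ e.symm) 2 S.measure := by
      rw [← hmap]
      refine MemLp.smul_measure ?_ ENNReal.ofReal_ne_top
      rw [e.memLp_map_measure_iff, Function.comp_assoc, e.symm_comp_self, Function.comp_id]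
      exact hf
    -- The factor `|a|` between the measures scales `L²` norms by `|a| ^ (1/2)`, which this
    -- tolerance compensates.
    obtain ⟨g, hg, hfg⟩ := h.dense _ hf' (|a| ^ (1 / 2 : ℝ) * ε) (by positivity)
    refine ⟨g.comp (C a * X + C b), S.comp_mem_polySpan_affine ha b hg, ?_⟩
    rw [← hmap, eLpNorm_smul_measure_of_ne_zero hc, e.measurableEmbedding.eLpNorm_map_measure,
      ENNReal.ofReal_mul (by positivity), smul_eq_mul,
      ENNReal.ofReal_rpow_of_pos ha' |>.symm] at hfg
    have h2 : (1 / (2 : ENNReal)).toReal = 1 / 2 := by simp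
    rw [h2] at hfg
    have h3 : ((fun z => (f ∘ e.symm) z - g.eval z) ∘ e)
        = fun z => f z - (g.comp (C a * X + C b)).eval z := by
      ext z
      have : e z = a * z + b := rfl
      simp [this]
      rw [← this, e.symm_apply_apply]
    rw [h3] at hfg
    refine (ENNReal.mul_le_mul_iff_right ?_ ?_).1 hfg
    · simp [ha]
    · simp

end SLData

/-! ### From the weight `W` to the classical weight `W η²` -/

/-- The weight equation is known only off the poles of `p`, `q` and the zeros of `p`. One-sided
limits of the derivative extend the Pearson equation across these isolated points. -/
theorem hasDerivAt_of_eventually_punctured {f g : ℝ → ℝ} {x : ℝ}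
    (f_diff : ∀ᶠ y in 𝓝[≠] x, HasDerivAt f (g y) y) (hf : ContinuousAt f x)
    (hg : ContinuousAt g x) : HasDerivAt f (g x) x := by
  have h1 : ∀ᶠ y in 𝓝[>] x, HasDerivAt f (g y) y :=
    f_diff.filter_mono (nhdsWithin_mono x fun y hy => ne_of_gt hy)
  have h2 : ∀ᶠ y in 𝓝[<] x, HasDerivAt f (g y) y :=
    f_diff.filter_mono (nhdsWithin_mono x fun y hy => ne_of_lt hy)
  have hd : DifferentiableOn ℝ f {y | HasDerivAt f (g y) y} := fun y hy =>
    (HasDerivAt.differentiableAt hy).differentiableWithinAt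
  have A : HasDerivWithinAt f (g x) (Set.Ici x) x := by
    refine hasDerivWithinAt_Ici_of_tendsto_deriv hd hf.continuousWithinAt h1 ?_
    exact (hg.tendsto.mono_left nhdsWithin_le_nhds).congr' (h1.mono fun y hy => hy.deriv.symm)
  have B : HasDerivWithinAt f (g x) (Set.Iic x) x := by
    refine hasDerivWithinAt_Iic_of_tendsto_deriv hd hf.continuousWithinAt h2 ?_
    exact (hg.tendsto.mono_left nhdsWithin_le_nhds).congr' (h2.mono fun y hy => hy.deriv.symm)
  simpa using B.union A

theorem eventually_eval_ne_zero {f : ℝ[X]} (hf : f ≠ 0) (x : ℝ) :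
    ∀ᶠ y in 𝓝[≠] x, f.eval y ≠ 0 := by
  have hfin : ({y | f.IsRoot y} \ {x}).Finite := (finite_setOfPred_isRoot hf).subset Set.sdiff_subset
  have h1 : ({y | f.IsRoot y} \ {x})ᶜ ∈ 𝓝 x := hfin.isClosed.compl_mem_nhds (by simp)
  filter_upwards [nhdsWithin_le_nhds h1, self_mem_nhdsWithin] with y hy hyx h0
  exact hy ⟨h0, hyx⟩

namespace RatDiffOp2.NaturalGauge

variable {T : RatDiffOp2} {p q η M : ℝ[X]}

theorem ratEval_p (h : T.NaturalGauge p q η M) (x : ℝ) : ratEval T.p x = p.eval x := by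
  rw [h.p_eq, ratEval, RatFunc.eval_algebraMap, Algebra.algebraMap_self_apply, eval₂_id]

/-- In the natural gauge, `V = W η²` satisfies the Pearson equation of the classical weights. -/
theorem hasDerivAt (h : T.NaturalGauge p q η M) {W : ℝ → ℝ} {I : Set ℝ} (hI : IsOpen I)
    (hW : T.IsWeightOn W I) {z : ℝ} (hz : z ∈ I) :
    HasDerivAt (fun x => p.eval x * (W x * η.eval x ^ 2)) (q.eval z * (W z * η.eval z ^ 2)) z := by
  have hWc : ContinuousAt W z := hW.continuousOn.continuousAt (hI.mem_nhds hz)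
  refine hasDerivAt_of_eventually_punctured (g := fun x => q.eval x * (W x * η.eval x ^ 2))
    ?_ (by fun_prop) (by fun_prop)
  filter_upwards [eventually_eval_ne_zero h.p_ne_zero z,
    eventually_eval_ne_zero T.q.denom_ne_zero z, nhdsWithin_le_nhds (hI.mem_nhds hz)]
    with x hp hq hx
  have hnum : T.p.num.eval x ≠ 0 := by rwa [h.p_eq, RatFunc.num_algebraMap]
  have hden : T.p.denom.eval x ≠ 0 := by rw [h.p_eq, RatFunc.denom_algebraMap]; simp
  have h1 := hW.hasDerivAt x hx hden hq hnum
  simp only [h.ratEval_p] at h1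
  rw [ratEval_eq_div] at h1
  have h2 := h1.mul ((η.hasDerivAt x).pow 2)
  have h3 : (fun x => p.eval x * (W x * η.eval x ^ 2))
      = (fun x => p.eval x * W x * η.eval x ^ 2) := by ext y; ring
  rw [h3]
  refine h2.congr_deriv ?_
  have e1 := congrArg (eval x) h.derivative_eta
  have e2 := congrArg (eval x) h.q_eq
  simp only [eval_mul, eval_add, eval_ofNat] at e1 e2
  have e3 : (derivative η).eval x = M.eval x * η.eval x / T.q.denom.eval x := by
    rw [eq_div_iff hq]; linarith
  have e4 : q.eval x = (T.q.num.eval x + 2 * p.eval x * M.eval x) / T.q.denom.eval x := by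
    rw [eq_div_iff hq]; linarith
  simp only [Pi.pow_apply, e3, e4]
  field_simp
  ring

/-- At a zero of `η` in `I`, `p ≠ 0` and `p W η²` tends to `0`, so `W η²` vanishes nearby. But `W >
0` and the zeros of `η` are isolated. -/
theorem eval_eta_ne_zero (h : T.NaturalGauge p q η M) {W : ℝ → ℝ} {I : Set ℝ} (hI : IsOpen I)
    (hc : I.OrdConnected) (hW : T.IsWeightOn W I) {z : ℝ} (hz : z ∈ I) : η.eval z ≠ 0 := by
  intro h0
  have hlim : Tendsto (fun x => p.eval x * (W x * η.eval x ^ 2)) (𝓝[I] z) (𝓝 0) := by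
    have := (h.hasDerivAt hI hW hz).continuousAt.tendsto
    simp only [h0] at this
    norm_num at this
    exact this.mono_left nhdsWithin_le_nhds
  have h1 := eventually_eq_zero_of_tendsto_zero hI hc (fun x hx => h.hasDerivAt hI hW hx)
    (subset_closure hz) (h.eval_p_ne_zero z h0) hlim
  obtain ⟨x, ⟨hx0, hx1⟩, hx2⟩ := (((h1.filter_mono nhdsWithin_le_nhds).and
    (nhdsWithin_le_nhds (hI.mem_nhds hz))).and (eventually_eval_ne_zero h.eta_ne_zero z)).exists
  have := hW.pos x hx1
  have h3 := hx0 hx1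
  simp [this.ne', hx2] at h3

end RatDiffOp2.NaturalGauge

namespace SLData

/-- Boundary conditions and moments are available for all polynomials, so the factor `η²` is
absorbed in the test polynomial. -/
theorem IsSLOPS.classicalWeight {S : SLData} (h : S.IsSLOPS) {p q η M : ℝ[X]}
    (hg : S.T.NaturalGauge p q η M) :
    ClassicalWeight S.I (fun x => S.W x * η.eval x ^ 2) p q where
  isOpen := h.isOpen_I
  ordConnected := h.ordConnected_I
  nonempty := h.nonempty_I
  pos z hz := by
    have h1 := h.weight.pos z hz
    have h2 := hg.eval_eta_ne_zero h.isOpen_I h.ordConnected_I h.weight hz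
    positivity
  p_ne_zero := hg.p_ne_zero
  natDegree_p := hg.natDegree_p
  natDegree_q := hg.natDegree_q
  hasDerivAt z hz := hg.hasDerivAt h.isOpen_I h.weight hz
  boundary_finite f e he := by
    refine (h.boundary_finite (f * η ^ 2) e he).congr fun x => ?_
    rw [hg.ratEval_p, eval_mul, eval_pow]
    ring
  boundary_infinite f := by
    refine (h.boundary_infinite (f * η ^ 2)).congr fun x => ?_
    rw [hg.ratEval_p, eval_mul, eval_pow]
    ring
  integrable := by
    refine (integrableOn_eval_mul h.moments (η ^ 2)).congr_fun (fun x _ => ?_)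
      h.isOpen_I.measurableSet
    simp only [eval_pow]
    ring

end SLData

end

theorem mainTheorem9 (S : SLData) (hS : S.IsSLOPS) :
    ∃ (a b : ℝ) (ha : a ≠ 0), (S.affine a b ha).IsSLOPS ∧
      ((S.affine a b ha).IsHermiteType ∨ (S.affine a b ha).IsLaguerreType ∨
        (S.affine a b ha).IsJacobiType) := by
  obtain ⟨p, q, η, M, hg⟩ := S.T.exists_naturalGauge S.exc S.y hS.degree_y hS.eigen
  obtain ⟨a, b, ha, c, hc, hstd⟩ := (hS.classicalWeight hg).isAffineStandardWeight
  refine ⟨a, b, ha, hS.affine ha b, ?_⟩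
  have hη : ∀ x, a * x + b ∈ S.I → η.eval (a * x + b) ≠ 0 := fun x hx =>
    hg.eval_eta_ne_zero hS.isOpen_I hS.ordConnected_I hS.weight hx
  -- Dividing by `√c` absorbs the constant left free by the classification into the denominator
  -- `θ²`.
  set θ : ℝ[X] := C (Real.sqrt c)⁻¹ * η.comp (C a * X + C b) with hθdef
  have hs : Real.sqrt c ≠ 0 := (Real.sqrt_pos.2 hc).ne'
  have hθe : ∀ x, θ.eval x = (Real.sqrt c)⁻¹ * η.eval (a * x + b) := fun x => by simp [hθdef]
  have hθ : ∀ x ∈ (S.affine a b ha).I, θ.eval x ≠ 0 := fun x hx => by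
    rw [hθe]
    exact mul_ne_zero (inv_ne_zero hs) (hη x hx)
  have hW : ∀ (x v : ℝ), x ∈ (S.affine a b ha).I → S.W (a * x + b) * η.eval (a * x + b) ^ 2 = c * v →
      (S.affine a b ha).W x = v / θ.eval x ^ 2 := by
    intro x v hx hv
    have h1 := hη x hx
    rw [hθe, mul_pow, inv_pow, Real.sq_sqrt hc.le, eq_div_iff (by positivity)]
    change S.W (a * x + b) * _ = v
    field_simp
    linarith
  rcases hstd with ⟨hI, hV⟩ | ⟨hI, α, hα, hV⟩ | ⟨hI, α, β, hα, hβ, hV⟩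
  · exact Or.inl ⟨hI, θ, hθ, fun x hx => hW x _ hx (hV x)⟩
  · exact Or.inr (Or.inl ⟨hI, α, hα, θ, hθ, fun x hx => hW x _ hx (hV x hx)⟩)
  · exact Or.inr (Or.inr ⟨hI, α, β, hα, hβ, θ, hθ, fun x hx => hW x _ hx (hV x hx)⟩)
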